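/- Let $K$ be an algebraically closed field of characteristic different from $2$. Let $f(x,z)\in K[x,z]$ be a homogeneous cubic polynomial with $x^3$-coefficient $1$ and $q(x,y,z)\in K[x,y,z]$ a homogeneous quadratic polynomial, and put $$P=y^2z-f(x,z),\qquad Q=w^2-q(x,y,z),\qquad C=V(P,Q)\subset\mathbb P^3=\operatorname{Proj}K[x,y,z,w].$$ The curve $C$ is called nonsingular (and is then called a DCEC) if the Jacobian matrix of $(P,Q)$ has rank $2$ at every point of $C$. We also write $V(P)$, $V(P,q)$ for the zero sets in $\mathbb P^2=\operatorname{Proj}K[x,y,z]$. Elliptic curves are given by Weierstrass equations in $\mathbb P^2$, with origin $O=(0:1:0)$. **Proposition.** Giving a nonsingular DCEC $C=V(P,Q)$ is equivalent to giving an elliptic curve $E$ together with a set $\{P_1,\dots,P_6\}$ of six distinct points of $E$ such that $\sum_{i=1}^6P_i=O$; the correspondence is $E=V(P)$, $\{P_1,\dots,P_6\}=V(P,q)$. Precisely: 1. If $C=V(P,Q)$ is nonsingular, then there are a unique elliptic curve $E$ with an equation $y^2z=x^3+bx^2z+cxz^2+dz^3$ and a unique set of six distinct points $P_1,\dots,P_6\in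 E$ with $\sum P_i=O$ such that $E=V(P)$ and $\{P_1,\dots,P_6\}=V(P,q)$. 2. For every elliptic curve $E$ with an equation $y^2z=x^3+bx^2z+cxz^2+dz^3$ and every set of six distinct points $P_1,\dots,P_6\in E$ with $\sum P_i=O$, there is a nonsingular $C=V(P,Q)$ as above with $E=V(P)$ and $\{P_1,\dots,P_6\}=V(P,q)$. 3. Let $C=V(P,Q)$ be nonsingular with $(E,\{P_i\})$ as in 1, and let $(f',q')$ be any pair as above, with $P'$, $Q'$, $C'=V(P',Q')$. Then the following are equivalent: (a) $V(P')=E$ and $V(P',q')=\{P_1,\dots,P_6\}$; (b) $f'=f$ and $q'=c\,q$ for some $c\in K^\times$; (c) $C'$ is the image of $C$ under $(x:y:z:w)\mapsto(x:y:z:uw)$ for some $u\in K^\times$. 4. For an arbitrary elliptic curve $E$ over $K$ (given by any Weierstrass equation) and six distinct points $P_1,\dots,P_6\in E$ with $\sum P_i=O$, there are a nonsingular $C=V(P,Q)$ as above and a linear automorphism of $\mathbb P^2$ fixing $O=(0:1:0)$ that maps $E$ onto $V(P)$ and $\{P_1,\dots,P_6\}$ onto $V(P,q)$. -/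

import Mathlib

open scoped LinearAlgebra.Projectivization

namespace DoubleCover

/-- The set `V(F₁, F₂, …)` of points of `ℙⁿ⁻¹(K)` at which all polynomials of `S` vanish.
(It is only applied to homogeneous polynomials, for which the choice of a representative
of the point does not matter.) -/
def zeroLocus {K : Type*} [Field K] {n : ℕ} (S : Set (MvPolynomial (Fin n) K)) :
    Set (ℙ K (Fin n → K)) :=
  {p | ∀ F ∈ S, MvPolynomial.eval p.rep F = 0}

/-- The data of the equations `P = y² z - f(x, z)` and `Q = w² - q(x, y, z)`:
a binary cubic form `f`, monic in `x`, and a ternary quadratic form `q`. -/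
structure Form (K : Type*) [Field K] where
  f : MvPolynomial (Fin 2) K
  f_homogeneous : f.IsHomogeneous 3
  f_monic : f.coeff (Finsupp.single 0 3) = 1
  q : MvPolynomial (Fin 3) K
  q_homogeneous : q.IsHomogeneous 2

namespace Form

variable {K : Type*} [Field K] (D : Form K)

/-- `y² z - f(x, z)` in `K[x, y, z]`. -/
noncomputable def cubic : MvPolynomial (Fin 3) K :=
  MvPolynomial.X 1 ^ 2 * MvPolynomial.X 2 - MvPolynomial.rename ![0, 2] D.f

/-- `P = y² z - f(x, z)` in `K[x, y, z, w]`. -/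
noncomputable def P : MvPolynomial (Fin 4) K :=
  MvPolynomial.rename Fin.castSucc D.cubic

/-- `Q = w² - q(x, y, z)` in `K[x, y, z, w]`. -/
noncomputable def Q : MvPolynomial (Fin 4) K :=
  MvPolynomial.X 3 ^ 2 - MvPolynomial.rename Fin.castSucc D.q

/-- The space curve `C = V(P, Q)` in `ℙ³`. -/
def curve : Set (ℙ K (Fin 4 → K)) := zeroLocus {D.P, D.Q}

/-- The plane curve `V(P)` in `ℙ²`. -/
def planeCubic : Set (ℙ K (Fin 3 → K)) := zeroLocus {D.cubic}

/-- The set `V(P, q)` in `ℙ²`. -/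
def branchPoints : Set (ℙ K (Fin 3 → K)) := zeroLocus {D.cubic, D.q}

/-- The Jacobian matrix of `(P, Q)` at `v`. -/
noncomputable def jacobian (v : Fin 4 → K) : Matrix (Fin 2) (Fin 4) K :=
  Matrix.of fun i j => MvPolynomial.eval v (MvPolynomial.pderiv j (![D.P, D.Q] i))

/-- `C = V(P, Q)` is nonsingular: the Jacobian matrix has rank `2` at every point of `C`. -/
def IsNonsingular : Prop :=
  ∀ v : Fin 4 → K, v ≠ 0 → MvPolynomial.eval v D.P = 0 → MvPolynomial.eval v D.Q = 0 →
    (D.jacobian v).rank = 2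

end Form

/-- The linear automorphism `(x, y, z, w) ↦ (x, y, z, u w)`. -/
def scaleW {K : Type*} [Field K] (u : Kˣ) : (Fin 4 → K) ≃ₗ[K] (Fin 4 → K) :=
  LinearEquiv.piCongrRight fun i => LinearEquiv.smulOfUnit (if i = 3 then u else 1)

/-- The automorphism of the projective space induced by a linear automorphism. -/
def projMap {K : Type*} [Field K] {n : ℕ} (g : (Fin n → K) ≃ₗ[K] (Fin n → K)) :
    ℙ K (Fin n → K) → ℙ K (Fin n → K) :=
  Projectivization.map g.toLinearMap g.injective

/-- The embedding in `ℙ²` of the points of a Weierstrass curve: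
`O ↦ (0 : 1 : 0)` and `(x, y) ↦ (x : y : 1)`. -/
def toPlane {K : Type*} [Field K] {E : WeierstrassCurve K} :
    E.toAffine.Point → ℙ K (Fin 3 → K)
  | .zero => Projectivization.mk K ![0, 1, 0] fun h => one_ne_zero (congrFun h 1)
  | .some x y _ => Projectivization.mk K ![x, y, 1] fun h => one_ne_zero (congrFun h 2)

/-- An elliptic curve over `K` with a set of six distinct points whose sum is `O`. -/
structure SixPointedEllipticCurve (K : Type*) [Field K] [DecidableEq K] where
  E : WeierstrassCurve K
  isElliptic : E.IsElliptic
  S : Finset E.toAffine.Point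
  card_eq : S.card = 6
  sum_eq : ∑ R ∈ S, R = 0

namespace SixPointedEllipticCurve

variable {K : Type*} [Field K] [DecidableEq K] (M : SixPointedEllipticCurve K)

/-- The elliptic curve as a subset of `ℙ²`. -/
def curve : Set (ℙ K (Fin 3 → K)) := Set.range (toPlane (E := M.E))

/-- The six points as a subset of `ℙ²`. -/
def points : Set (ℙ K (Fin 3 → K)) := toPlane '' (M.S : Set M.E.toAffine.Point)

end SixPointedEllipticCurve

/-- The correspondence: `E = V(P)` and `{P₁, …, P₆} = V(P, q)`. -/
def Corresponds {K : Type*} [Field K] [DecidableEq K] (D : Form K)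
    (M : SixPointedEllipticCurve K) : Prop :=
  M.curve = D.planeCubic ∧ M.points = D.branchPoints

end DoubleCover

/-! On a smooth cubic $E$, restricting quadratic forms identifies them with the functions having a
pole only at $O$, of order at most 6. If such a function is nonzero, it has divisor $Z-6O$ with $Z$
effective of degree 6, so $Z$ sums to $O$. Conversely every effective $Z$ of degree 6 and sum $O$
arises, from a form unique up to a scalar. The curve $w^2=q$ over $E$ is nonsingular exactly when
$Z$ has no multiple point: where $w\ne0$ the Jacobian entry $2w$ suffices, and where $w=0$ rank 2
means that conic and cubic meet transversally.

The proof works in the coordinate ring of the affine curve, where $O$ is invisible and has the unit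
ideal. By injectivity of the map to the class group, points sum to zero iff the product of their
ideals is principal (`sum_eq_zero_iff`). The degree of the norm of a function is its pole order at
$O$, and also the dimension of the quotient by it, which counts affine zeros. For a transversal
conic it is 6, or 5 when the $y^2$-coefficient vanishes; in the latter case $O$ is the sixth zero.

Transversality passes to a factorization into distinct point ideals by Nakayama
(`prod_pointIdeal_eq_span`) and back by a tangent vector over the dual numbers
(`affine_transversal_of_prod_eq_span`). Comparing norm degrees gives uniqueness of $q$ up to a
scalar (`exists_eq_scale`). Completing the square reduces a general Weierstrass equation to the
normal form. -/

namespace DoubleCover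

open Polynomial WeierstrassCurve.Affine
open scoped Polynomial.Bivariate

/-! ### Point ideals in the affine coordinate ring and the group law -/

section CoordinateRing

variable {K : Type*} [Field K] {W : WeierstrassCurve.Affine K}

variable (W) in
/-- The coordinate function `x` on the affine curve `W`. -/
noncomputable def xCoord : W.CoordinateRing := CoordinateRing.mk W (C X)

variable (W) in
/-- The coordinate function `y` on the affine curve `W`. -/
noncomputable def yCoord : W.CoordinateRing := CoordinateRing.mk W Y

theorem aeval_xCoord (p : K[X]) : aeval (xCoord W) p = algebraMap K[X] W.CoordinateRing p := by
  have : xCoord W = algebraMap K[X] W.CoordinateRing X := rfl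
  rw [this, aeval_algebraMap_apply, aeval_X_left_apply]

theorem exists_eq_aeval_add (r : W.CoordinateRing) :
    ∃ p q : K[X], r = aeval (xCoord W) p + aeval (xCoord W) q * yCoord W := by
  obtain ⟨p, q, rfl⟩ := CoordinateRing.exists_smul_basis_eq r
  refine ⟨p, q, ?_⟩
  rw [aeval_xCoord, aeval_xCoord, Algebra.smul_def, Algebra.smul_def, mul_one]
  rfl

theorem aeval_add_eq_smul_basis (p q : K[X]) :
    aeval (xCoord W) p + aeval (xCoord W) q * yCoord W
      = p • (1 : W.CoordinateRing) + q • CoordinateRing.mk W Y := by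
  rw [aeval_xCoord, aeval_xCoord, Algebra.smul_def, Algebra.smul_def, mul_one]
  rfl

theorem coord_equation : yCoord W ^ 2 + algebraMap K _ W.a₁ * xCoord W * yCoord W
    + algebraMap K _ W.a₃ * yCoord W = xCoord W ^ 3 + algebraMap K _ W.a₂ * xCoord W ^ 2
    + algebraMap K _ W.a₄ * xCoord W + algebraMap K _ W.a₆ := by
  have h : CoordinateRing.mk W W.polynomial = 0 := AdjoinRoot.mk_self
  simp only [WeierstrassCurve.Affine.polynomial] at h
  have e (a : K) : CoordinateRing.mk W (C (C a)) = algebraMap K _ a := rfl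
  simp only [map_sub, map_add, map_mul, map_pow, e] at h
  rw [← sub_eq_zero, ← h, xCoord, yCoord]
  ring

/-- The algebra homomorphism from the coordinate ring given by a point with coordinates in an
algebra. -/
noncomputable def coordHom {A : Type*} [CommRing A] [Algebra K A] (x y : A)
    (h : y ^ 2 + algebraMap K A W.a₁ * x * y + algebraMap K A W.a₃ * y
      = x ^ 3 + algebraMap K A W.a₂ * x ^ 2 + algebraMap K A W.a₄ * x + algebraMap K A W.a₆) :
    W.CoordinateRing →ₐ[K] A :=
  AdjoinRoot.liftAlgHom W.polynomial (aeval x) y (by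
    simp only [WeierstrassCurve.Affine.polynomial]
    simp only [eval₂_sub, eval₂_add, eval₂_mul, eval₂_pow, eval₂_X, eval₂_C]
    simp only [RingHom.coe_coe, map_add, map_mul, map_pow, aeval_X, aeval_C]
    linear_combination h)

section

variable {A : Type*} [CommRing A] [Algebra K A] {x y : A}
    (h : y ^ 2 + algebraMap K A W.a₁ * x * y + algebraMap K A W.a₃ * y
      = x ^ 3 + algebraMap K A W.a₂ * x ^ 2 + algebraMap K A W.a₄ * x + algebraMap K A W.a₆)

@[simp]
theorem coordHom_xCoord : coordHom x y h (xCoord W) = x := by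
  rw [coordHom, xCoord]
  erw [AdjoinRoot.liftAlgHom_mk]
  simp

@[simp]
theorem coordHom_yCoord : coordHom x y h (yCoord W) = y := by
  rw [coordHom, yCoord]
  erw [AdjoinRoot.liftAlgHom_mk]
  simp

theorem coordRing_algHom_ext {φ ψ : W.CoordinateRing →ₐ[K] A} (hx : φ (xCoord W) = ψ (xCoord W))
    (hy : φ (yCoord W) = ψ (yCoord W)) : φ = ψ := by
  refine AlgHom.ext fun r => ?_
  obtain ⟨p, q, rfl⟩ := exists_eq_aeval_add r
  simp only [map_add, map_mul, ← aeval_algHom_apply, hx, hy]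

end

theorem XYIdeal_eq_span (x y : K) : CoordinateRing.XYIdeal W x (C y)
    = Ideal.span {xCoord W - algebraMap K _ x, yCoord W - algebraMap K _ y} := by
  rw [CoordinateRing.XYIdeal, CoordinateRing.XClass, CoordinateRing.YClass, C_sub, map_sub, map_sub]
  rfl

/-- Evaluation of a regular function at an affine point. -/
noncomputable def evalAt {x y : K} (h : W.Equation x y) : W.CoordinateRing →ₐ[K] K :=
  coordHom x y (by simpa using (equation_iff ..).mp h)

@[simp]
theorem evalAt_xCoord {x y : K} (h : W.Equation x y) : evalAt h (xCoord W) = x :=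
  coordHom_xCoord _

@[simp]
theorem evalAt_yCoord {x y : K} (h : W.Equation x y) : evalAt h (yCoord W) = y :=
  coordHom_yCoord _

/-- An algebra homomorphism on the coordinate ring is determined by the images of $x$ and $y$, so
reduction modulo the ideal is evaluation followed by the inclusion of constants. -/
theorem sub_evalAt_mem {x y : K} (h : W.Equation x y) (r : W.CoordinateRing) :
    r - algebraMap K _ (evalAt h r) ∈ CoordinateRing.XYIdeal W x (C y) := by
  rw [XYIdeal_eq_span]
  set I := Ideal.span {xCoord W - algebraMap K _ x, yCoord W - algebraMap K _ y}
  have hx : Ideal.Quotient.mkₐ K I (xCoord W) = algebraMap K _ x := by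
    rw [← (Ideal.Quotient.mkₐ K I).commutes, Ideal.Quotient.mkₐ_eq_mk]
    exact Ideal.Quotient.eq.mpr (Ideal.subset_span (by simp))
  have hy : Ideal.Quotient.mkₐ K I (yCoord W) = algebraMap K _ y := by
    rw [← (Ideal.Quotient.mkₐ K I).commutes, Ideal.Quotient.mkₐ_eq_mk]
    exact Ideal.Quotient.eq.mpr (Ideal.subset_span (by simp))
  have : Ideal.Quotient.mkₐ K I = (Algebra.ofId K _).comp (evalAt h) :=
    coordRing_algHom_ext (by simpa using hx) (by simpa using hy)
  rw [← Ideal.Quotient.eq, ← Ideal.Quotient.mkₐ_eq_mk K, this]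
  simp [Algebra.ofId_apply]

theorem mem_XYIdeal_iff {x y : K} (h : W.Equation x y) (r : W.CoordinateRing) :
    r ∈ CoordinateRing.XYIdeal W x (C y) ↔ evalAt h r = 0 := by
  constructor
  · intro hr
    have : CoordinateRing.XYIdeal W x (C y) ≤ RingHom.ker (evalAt h) := by
      rw [XYIdeal_eq_span, Ideal.span_le]
      rintro _ (rfl | rfl) <;> simp [RingHom.mem_ker]
    exact this hr
  · intro hr
    simpa [hr] using sub_evalAt_mem h r

theorem XYIdeal_isMaximal {x y : K} (h : W.Equation x y) :
    (CoordinateRing.XYIdeal W x (C y)).IsMaximal := by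
  have : CoordinateRing.XYIdeal W x (C y) = RingHom.ker (evalAt h) := by
    ext r
    rw [mem_XYIdeal_iff h, RingHom.mem_ker]
  rw [this]
  exact RingHom.ker_isMaximal_of_surjective _ fun a => ⟨algebraMap K _ a, by simp⟩

/-- The ideal of functions vanishing at a point; the unit ideal for the point at infinity. -/
noncomputable def pointIdeal : W.Point → Ideal W.CoordinateRing
  | .zero => ⊤
  | .some x y _ => CoordinateRing.XYIdeal W x (C y)

theorem pointIdeal_zero : pointIdeal (0 : W.Point) = ⊤ := rfl

theorem pointIdeal_isMaximal {P : W.Point} (hP : P ≠ 0) : (pointIdeal P).IsMaximal := by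
  rcases P with _ | ⟨x, y, h⟩
  · exact absurd rfl hP
  · exact XYIdeal_isMaximal h.1

theorem pointIdeal_le_iff {P Q : W.Point} (hQ : Q ≠ 0) : pointIdeal P ≤ pointIdeal Q ↔ P = Q := by
  refine ⟨fun h => ?_, fun h => h ▸ le_rfl⟩
  rcases P with _ | ⟨x, y, hP⟩
  · exact absurd (top_le_iff.mp h) (pointIdeal_isMaximal hQ).ne_top
  rcases Q with _ | ⟨x', y', hQ'⟩
  · exact absurd rfl hQ
  have hx := h (show xCoord W - algebraMap K _ x ∈ CoordinateRing.XYIdeal W x (C y) by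
    rw [XYIdeal_eq_span]; exact Ideal.subset_span (by simp))
  have hy := h (show yCoord W - algebraMap K _ y ∈ CoordinateRing.XYIdeal W x (C y) by
    rw [XYIdeal_eq_span]; exact Ideal.subset_span (by simp))
  simp only [pointIdeal, mem_XYIdeal_iff hQ'.1, map_sub, evalAt_xCoord, evalAt_yCoord,
    AlgHom.commutes, Algebra.algebraMap_self, RingHom.id_apply, sub_eq_zero] at hx hy
  subst hx hy
  rfl

theorem pointIdeal_isCoprime {P Q : W.Point} (h : P ≠ Q) :
    IsCoprime (pointIdeal P) (pointIdeal Q) := by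
  rw [Ideal.isCoprime_iff_sup_eq]
  by_cases hP : P = 0
  · rw [hP, pointIdeal_zero, top_sup_eq]
  by_cases hQ : Q = 0
  · rw [hQ, pointIdeal_zero, sup_top_eq]
  exact (pointIdeal_isMaximal hP).coprime_of_ne (pointIdeal_isMaximal hQ)
    fun e => h ((pointIdeal_le_iff hQ).mp e.le)

theorem prod_pointIdeal_eq_iInf (S : Finset W.Point) :
    ∏ P ∈ S, pointIdeal P = ⨅ P ∈ S, pointIdeal P :=
  Ideal.prod_eq_iInf_of_pairwise_isCoprime fun _ _ _ _ h => pointIdeal_isCoprime h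

theorem mem_prod_pointIdeal {S : Finset W.Point} {r : W.CoordinateRing} :
    r ∈ ∏ P ∈ S, pointIdeal P ↔ ∀ P ∈ S, r ∈ pointIdeal P := by
  simp [prod_pointIdeal_eq_iInf]

theorem prod_pointIdeal_le_iff {S : Finset W.Point} {P : W.Point} (hP : P ≠ 0) :
    ∏ Q ∈ S, pointIdeal Q ≤ pointIdeal P ↔ P ∈ S := by
  rw [Ideal.IsPrime.prod_le (pointIdeal_isMaximal hP).isPrime]
  constructor
  · rintro ⟨Q, hQ, h⟩
    rwa [← (pointIdeal_le_iff hP).mp h]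
  · exact fun h => ⟨P, h, le_rfl⟩

open scoped nonZeroDivisors in
/-- The invertible fractional ideal of a point. -/
noncomputable def pointUnit : W.Point → (FractionalIdeal W.CoordinateRing⁰ W.FunctionField)ˣ
  | .zero => 1
  | .some _ _ h => CoordinateRing.XYIdeal' (W := W) h

open scoped nonZeroDivisors in
theorem coe_pointUnit (P : W.Point) :
    (pointUnit P : FractionalIdeal W.CoordinateRing⁰ W.FunctionField) = pointIdeal P := by
  rcases P with _ | ⟨x, y, h⟩
  · simp [pointUnit, pointIdeal]
  · exact CoordinateRing.XYIdeal'_eq h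

theorem toClass_eq_mk_pointUnit [DecidableEq K] (P : W.Point) :
    Point.toClass P = Additive.ofMul (ClassGroup.mk W.FunctionField (pointUnit P)) := by
  rcases P with _ | ⟨x, y, h⟩
  · exact (map_one (ClassGroup.mk W.FunctionField)).symm
  · exact Point.toClass_some h

open scoped nonZeroDivisors in
/-- Points of a Weierstrass curve add up to zero if and only if the product of their ideals is
principal. -/
theorem sum_eq_zero_iff [DecidableEq K] (S : Finset W.Point) :
    ∑ P ∈ S, P = 0 ↔ ∃ r : W.CoordinateRing, r ≠ 0 ∧ ∏ P ∈ S, pointIdeal P = Ideal.span {r} := by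
  have hcoe : ((∏ P ∈ S, pointUnit P : (FractionalIdeal W.CoordinateRing⁰ W.FunctionField)ˣ) :
      FractionalIdeal W.CoordinateRing⁰ W.FunctionField)
        = ((∏ P ∈ S, pointIdeal P : Ideal W.CoordinateRing) : FractionalIdeal _ _) := by
    classical
    induction S using Finset.induction with
    | empty => simp
    | insert P S hP ih =>
      rw [Finset.prod_insert hP, Finset.prod_insert hP, Units.val_mul, ih, coe_pointUnit,
        FractionalIdeal.coeIdeal_mul]
  -- `toClass` is an injective homomorphism, so the sum is zero iff the class of the product ideal
  -- is trivial, that is, iff this ideal is principal.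
  rw [← ClassGroup.mk_eq_one_of_coe_ideal hcoe, ← Point.toClass_injective.eq_iff, map_sum, map_zero,
    map_prod]
  simp only [toClass_eq_mk_pointUnit, ← ofMul_prod, ofMul_eq_zero]

end CoordinateRing

/-! ### Counting zeros; factorization into point ideals -/

section Divisors

variable {K : Type*} [Field K] {W : WeierstrassCurve.Affine K}

theorem finrank_quotient_pointIdeal {P : W.Point} (hP : P ≠ 0) :
    Module.finrank K (W.CoordinateRing ⧸ pointIdeal P) = 1 := by
  rcases P with _ | ⟨x, y, h⟩
  · exact absurd rfl hP
  · rw [← Module.finrank_self K]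
    exact (CoordinateRing.quotientXYIdealEquiv h.1).toLinearEquiv.finrank_eq

theorem finite_quotient_pointIdeal (P : W.Point) :
    Module.Finite K (W.CoordinateRing ⧸ pointIdeal P) := by
  by_cases hP : P = 0
  · have : Subsingleton (W.CoordinateRing ⧸ pointIdeal P) := by
      rw [hP, pointIdeal_zero]; infer_instance
    infer_instance
  · exact Module.finite_of_finrank_pos (by rw [finrank_quotient_pointIdeal hP]; exact one_pos)

/-- Chinese remainder theorem: the quotient is a product of copies of $K$, one for each point. The
point at infinity must be excluded, as its quotient is zero. -/
theorem finrank_quotient_prod_pointIdeal {S : Finset W.Point} (hS : ∀ P ∈ S, P ≠ 0) :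
    Module.finrank K (W.CoordinateRing ⧸ ∏ P ∈ S, pointIdeal P) = S.card := by
  classical
  let f : W.CoordinateRing →ₗ[W.CoordinateRing] (P : S) → W.CoordinateRing ⧸ pointIdeal P.1 :=
    LinearMap.pi fun P => (pointIdeal P.1).mkQ
  have hf : Function.Surjective f := Ideal.pi_mkQ_surjective
    (I := fun P : S => pointIdeal P.1) fun P Q h => pointIdeal_isCoprime (Subtype.coe_injective.ne h)
  have hker : LinearMap.ker f = ∏ P ∈ S, pointIdeal P := by
    rw [LinearMap.ker_pi, prod_pointIdeal_eq_iInf, iInf_subtype]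
    simp
  have e := ((Submodule.quotEquivOfEq _ _ hker.symm).trans
    (f.quotKerEquivOfSurjective hf)).restrictScalars K
  have (P : S) := finite_quotient_pointIdeal P.1
  have (P : S) : Module.Free K (W.CoordinateRing ⧸ pointIdeal P.1) := inferInstance
  rw [e.finrank_eq, Module.finrank_pi_fintype,
    Finset.sum_congr rfl fun P _ => finrank_quotient_pointIdeal (hS P.1 P.2)]
  simp

theorem finrank_quotient_span {r : W.CoordinateRing} (hr : r ≠ 0) :
    Module.finrank K (W.CoordinateRing ⧸ Ideal.span {r}) = (Algebra.norm K[X] r).natDegree :=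
  finrank_quotient_span_eq_natDegree_norm (CoordinateRing.basis W) hr

theorem finite_quotient_span {r : W.CoordinateRing} (hr : r ≠ 0) :
    Module.Finite K (W.CoordinateRing ⧸ Ideal.span {r}) := by
  have h : Ideal.span {r} ≠ ⊥ := by simpa using hr
  exact Module.Finite.equiv
    (Ideal.quotientEquivDirectSum K (CoordinateRing.basis W) h).symm

/-- A nonzero function has at most as many zeros as the degree of its norm. -/
theorem card_le_natDegree_norm {S : Finset W.Point} (hS : ∀ P ∈ S, P ≠ 0) {r : W.CoordinateRing}
    (hr : r ≠ 0) (h : ∀ P ∈ S, r ∈ pointIdeal P) : S.card ≤ (Algebra.norm K[X] r).natDegree := by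
  rw [← finrank_quotient_span hr, ← finrank_quotient_prod_pointIdeal hS]
  have := finite_quotient_span hr
  have hle : Ideal.span {r} ≤ ∏ P ∈ S, pointIdeal P := by
    rw [Ideal.span_singleton_le_iff_mem, mem_prod_pointIdeal]
    exact h
  exact LinearMap.finrank_le_finrank_of_surjective
    (f := (Ideal.Quotient.factorₐ K hle).toLinearMap) (Ideal.Quotient.factor_surjective hle)

/-- A nonzero function has finitely many affine zeros. -/
theorem finite_zeros {r : W.CoordinateRing} (hr : r ≠ 0) :
    {P : W.Point | P ≠ 0 ∧ r ∈ pointIdeal P}.Finite := by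
  by_contra h
  obtain ⟨S, hS, hcard⟩ := Set.Infinite.exists_subset_card_eq h
    ((Algebra.norm K[X] r).natDegree + 1)
  have := card_le_natDegree_norm (fun P hP => (hS hP).1) hr fun P hP => (hS hP).2
  omega

/-- Both sides are the dimension over $K$ of the quotient by the same ideal. -/
theorem natDegree_norm_eq_card {S : Finset W.Point} (hS : ∀ P ∈ S, P ≠ 0) {r : W.CoordinateRing}
    (hr : r ≠ 0) (h : ∏ P ∈ S, pointIdeal P = Ideal.span {r}) :
    (Algebra.norm K[X] r).natDegree = S.card := by
  rw [← finrank_quotient_span hr, ← finrank_quotient_prod_pointIdeal hS, h]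

/-- The maximal ideals of the coordinate ring over an algebraically closed field are the ideals
of points. -/
theorem exists_eq_pointIdeal [IsAlgClosed K] (hW : ∀ x y, W.Equation x y → W.Nonsingular x y)
    (M : Ideal W.CoordinateRing) [hM : M.IsMaximal] : ∃ P : W.Point, P ≠ 0 ∧ M = pointIdeal P := by
  let _ := Ideal.Quotient.field M
  -- Nullstellensatz: the residue field is finite over $K$, hence equal to $K$, and the images of
  -- the coordinates are the coordinates of a point.
  have : Algebra.FiniteType K (W.CoordinateRing ⧸ M) := inferInstance
  have : Module.Finite K (W.CoordinateRing ⧸ M) := finite_of_finite_type_of_isJacobsonRing K _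
  have hb := IsAlgClosed.algebraMap_bijective_of_isIntegral (k := K) (K := W.CoordinateRing ⧸ M)
  obtain ⟨x, hx⟩ := hb.2 (Ideal.Quotient.mkₐ K M (xCoord W))
  obtain ⟨y, hy⟩ := hb.2 (Ideal.Quotient.mkₐ K M (yCoord W))
  have heq : W.Equation x y := by
    rw [equation_iff]
    apply hb.1
    have := congrArg (Ideal.Quotient.mkₐ K M) (coord_equation (W := W))
    simp only [map_add, map_mul, map_pow, AlgHom.commutes, ← hx, ← hy] at this ⊢
    exact this
  refine ⟨.some x y (hW x y heq), Point.some_ne_zero _, ?_⟩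
  refine ((XYIdeal_isMaximal heq).eq_of_le hM.ne_top ?_).symm
  rw [XYIdeal_eq_span, Ideal.span_le]
  rintro _ (rfl | rfl)
  · rw [SetLike.mem_coe, ← Ideal.Quotient.eq_zero_iff_mem, ← Ideal.Quotient.mkₐ_eq_mk K, map_sub,
      ← hx, AlgHom.commutes, sub_self]
  · rw [SetLike.mem_coe, ← Ideal.Quotient.eq_zero_iff_mem, ← Ideal.Quotient.mkₐ_eq_mk K, map_sub,
      ← hy, AlgHom.commutes, sub_self]

/-- Used with $H=(r)$ and $J_i=I_i^2$, to combine the first-order conditions at the single points.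
-/
theorem prod_le_sup_prod {ι R : Type*} [CommRing R] (S : Finset ι) (H : Ideal R)
    (I J : ι → Ideal R) (h : ∀ i ∈ S, I i ≤ H ⊔ J i) : ∏ i ∈ S, I i ≤ H ⊔ ∏ i ∈ S, J i := by
  classical
  induction S using Finset.induction with
  | empty => simp
  | insert i S hi ih =>
    rw [Finset.prod_insert hi, Finset.prod_insert hi]
    refine (Ideal.mul_mono (h i (by simp)) (ih fun j hj => h j (by simp [hj]))).trans ?_
    rw [Ideal.sup_mul, Ideal.mul_sup (J i)]
    exact sup_le (Ideal.mul_le_left.trans le_sup_left)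
      (sup_le (Ideal.mul_le_right.trans le_sup_left) le_sup_right)

/-- If a function vanishes exactly at the points of `S` among the affine points, and vanishes there
to first order, then its ideal is the product of the ideals of these points. -/
theorem prod_pointIdeal_eq_span [IsAlgClosed K] (hW : ∀ x y, W.Equation x y → W.Nonsingular x y)
    {S : Finset W.Point} {r : W.CoordinateRing}
    (hS : ∀ P : W.Point, P ≠ 0 → (P ∈ S ↔ r ∈ pointIdeal P))
    (h : ∀ P ∈ S, pointIdeal P ≤ Ideal.span {r} ⊔ pointIdeal P ^ 2) (h0 : 0 ∉ S) :
    ∏ P ∈ S, pointIdeal P = Ideal.span {r} := by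
  set J := ∏ P ∈ S, pointIdeal P with hJ
  have hne {P} (hP : P ∈ S) : P ≠ 0 := fun e => h0 (e ▸ hP)
  have hrJ : Ideal.span {r} ≤ J := by
    rw [Ideal.span_singleton_le_iff_mem, mem_prod_pointIdeal]
    exact fun P hP => (hS P (hne hP)).mp hP
  refine le_antisymm ?_ hrJ
  have hle : J ≤ Ideal.span {r} ⊔ J ^ 2 := by
    rw [hJ, ← Finset.prod_pow]
    exact prod_le_sup_prod S _ _ _ h
  let N : Submodule W.CoordinateRing (W.CoordinateRing ⧸ Ideal.span {r}) :=
    Submodule.map (Ideal.span {r}).mkQ J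
  have hN : N ≤ J • N := by
    rw [← Submodule.map_smul'']
    refine (Submodule.map_mono hle).trans ?_
    rw [Submodule.map_sup, Submodule.mkQ_map_self, bot_sup_eq, pow_two]
    exact le_rfl
  -- Nakayama for $N=J/(r)$, which satisfies $N\subseteq JN$: some $s\equiv1$ modulo $J$ has
  -- $sJ\subseteq(r)$.
  obtain ⟨s, hs, hsN⟩ := Submodule.exists_sub_one_mem_and_smul_eq_zero_of_fg_of_le_smul J N
    ((IsNoetherian.noetherian J).map _) hN
  have hsJ : ∀ j ∈ J, s * j ∈ Ideal.span {r} := fun j hj => by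
    have := hsN _ (Submodule.mem_map_of_mem hj)
    rw [← map_smul, Submodule.mkQ_apply, Submodule.Quotient.mk_eq_zero] at this
    exact this
  -- A maximal ideal containing $r$ belongs to a point of `S`, so it contains $J$ and with it $s-1$;
  -- it cannot contain $s$.
  have htop : Ideal.span {s} ⊔ Ideal.span {r} = ⊤ := by
    by_contra hn
    obtain ⟨M, hM, hle⟩ := Ideal.exists_le_maximal _ hn
    obtain ⟨P, hP, rfl⟩ := exists_eq_pointIdeal hW M
    have hPS := (hS P hP).mpr (hle (Ideal.mem_sup_right (Ideal.mem_span_singleton_self r)))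
    have h1 := (prod_pointIdeal_le_iff hP).mpr hPS hs
    have h2 := hle (Ideal.mem_sup_left (Ideal.mem_span_singleton_self s))
    exact hM.ne_top ((Ideal.eq_top_iff_one _).mpr (by simpa using sub_mem h2 h1))
  calc J = (Ideal.span {s} ⊔ Ideal.span {r}) * J := by rw [htop, Ideal.top_mul]
    _ ≤ Ideal.span {r} := by
      rw [Ideal.sup_mul]
      refine sup_le ?_ Ideal.mul_le_left
      rw [Ideal.span_singleton_mul_le_iff]
      exact hsJ

/-- A tangent vector at a point `P` on which all functions of a product of distinct point ideals
including that of `P` vanish to second order is zero. -/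
theorem tangent_eq_zero {x y t u : K} (hP : W.Nonsingular x y) {S : Finset W.Point}
    (hS : .some x y hP ∈ S) {r : W.CoordinateRing} (hr : ∏ P ∈ S, pointIdeal P = Ideal.span {r})
    (φ : W.CoordinateRing →ₐ[K] DualNumber K)
    (hx : φ (xCoord W) = algebraMap K _ x + t • DualNumber.eps)
    (hy : φ (yCoord W) = algebraMap K _ y + u • DualNumber.eps) (hφ : φ r = 0) :
    t = 0 ∧ u = 0 := by
  classical
  have hφJ : ∀ j ∈ ∏ P ∈ S, pointIdeal P, φ j = 0 := fun j hj => by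
    rw [hr, Ideal.mem_span_singleton] at hj
    obtain ⟨k, rfl⟩ := hj
    rw [map_mul, hφ, zero_mul]
  have hev : (TrivSqZeroExt.fstHom K K K).comp φ = evalAt hP.1 := by
    refine coordRing_algHom_ext ?_ ?_
    · simp [hx, TrivSqZeroExt.algebraMap_eq_inl]
    · simp [hy, TrivSqZeroExt.algebraMap_eq_inl]
  -- Choose $s$ vanishing at the other points of `S` but not at this one. Then $as$ lies in the
  -- product for every $a$ in the ideal of the point, so $\varphi(a)\varphi(s)=0$, and $\varphi(s)$
  -- has nonzero constant term.
  have hne : ¬ ∏ Q ∈ S.erase (.some x y hP), pointIdeal Q ≤ pointIdeal (.some x y hP) := by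
    rw [prod_pointIdeal_le_iff (Point.some_ne_zero hP)]
    simp
  obtain ⟨s, hs, hsP⟩ := SetLike.not_le_iff_exists.mp hne
  have hs0 : (φ s).fst ≠ 0 := by
    have := congrArg (fun f => f s) hev
    simp only [AlgHom.comp_apply, TrivSqZeroExt.fstHom_apply] at this
    rw [this]
    exact fun h => hsP ((mem_XYIdeal_iff hP.1 s).mpr h)
  have key {a : W.CoordinateRing} (ha : a ∈ pointIdeal (.some x y hP)) : φ a * φ s = 0 := by
    rw [← map_mul]
    refine hφJ _ ?_
    rw [← Finset.mul_prod_erase S _ hS]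
    exact Ideal.mul_mem_mul ha hs
  constructor
  · have := key (a := xCoord W - algebraMap K _ x) ((mem_XYIdeal_iff hP.1 _).mpr (by simp))
    rw [map_sub, hx, AlgHom.commutes, add_sub_cancel_left] at this
    simpa [hs0] using congrArg TrivSqZeroExt.snd this
  · have := key (a := yCoord W - algebraMap K _ y) ((mem_XYIdeal_iff hP.1 _).mpr (by simp))
    rw [map_sub, hy, AlgHom.commutes, add_sub_cancel_left] at this
    simpa [hs0] using congrArg TrivSqZeroExt.snd this

end Divisors

/-! ### Equations in coordinates and the Jacobian matrix -/

/-- The coefficients of a ternary quadratic form. -/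
@[ext]
structure Quad (K : Type*) where
  xx : K
  xy : K
  yy : K
  xz : K
  yz : K
  zz : K

section Forms

variable {K : Type*} [Field K]

namespace Quad

variable (Q : Quad K)

/-- The value of a quadratic form. -/
def value (x y z : K) : K :=
  Q.xx * x ^ 2 + Q.xy * (x * y) + Q.yy * y ^ 2 + Q.xz * (x * z) + Q.yz * (y * z) + Q.zz * z ^ 2

/-- The partial derivative of a quadratic form with respect to `x`. -/
def dx (x y z : K) : K := 2 * Q.xx * x + Q.xy * y + Q.xz * z

/-- The partial derivative of a quadratic form with respect to `y`. -/
def dy (x y z : K) : K := Q.xy * x + 2 * Q.yy * y + Q.yz * z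

/-- The partial derivative of a quadratic form with respect to `z`. -/
def dz (x y z : K) : K := Q.xz * x + Q.yz * y + 2 * Q.zz * z

/-- The quadratic form as a polynomial. -/
noncomputable def toMvPolynomial : MvPolynomial (Fin 3) K :=
  .C Q.xx * .X 0 ^ 2 + .C Q.xy * (.X 0 * .X 1) + .C Q.yy * .X 1 ^ 2 + .C Q.xz * (.X 0 * .X 2)
    + .C Q.yz * (.X 1 * .X 2) + .C Q.zz * .X 2 ^ 2

theorem isHomogeneous_toMvPolynomial : Q.toMvPolynomial.IsHomogeneous 2 := by
  have h (i j : Fin 3) (a : K) : (MvPolynomial.C a * (.X i * .X j)).IsHomogeneous 2 :=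
    ((MvPolynomial.isHomogeneous_X K i).mul (MvPolynomial.isHomogeneous_X K j)).C_mul a
  simp only [toMvPolynomial, pow_two]
  exact (((((h 0 0 _).add (h 0 1 _)).add (h 1 1 _)).add (h 0 2 _)).add (h 1 2 _)).add (h 2 2 _)

end Quad

theorem exists_eq_toMvPolynomial {q : MvPolynomial (Fin 3) K} (hq : q.IsHomogeneous 2) :
    ∃ Q : Quad K, q = Q.toMvPolynomial := by
  let e (i j k : ℕ) : Fin 3 →₀ ℕ := Finsupp.equivFunOnFinite.symm ![i, j, k]
  have he (m : Fin 3 →₀ ℕ) (i j k : ℕ) : e i j k = m ↔ i = m 0 ∧ j = m 1 ∧ k = m 2 := by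
    simp [e, DFunLike.ext_iff, Fin.forall_fin_succ]
  have hX (i j k : ℕ) (a : K) : MvPolynomial.C a * (.X 0 ^ i * .X 1 ^ j * .X 2 ^ k)
      = MvPolynomial.monomial (e i j k) a := by
    rw [MvPolynomial.monomial_eq, Finsupp.prod_fintype _ _ (by simp)]
    simp [Fin.prod_univ_succ, e, mul_assoc]
  refine ⟨⟨q.coeff (e 2 0 0), q.coeff (e 1 1 0), q.coeff (e 0 2 0), q.coeff (e 1 0 1),
    q.coeff (e 0 1 1), q.coeff (e 0 0 2)⟩, ?_⟩
  have hsum : Quad.toMvPolynomial ⟨q.coeff (e 2 0 0), q.coeff (e 1 1 0), q.coeff (e 0 2 0),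
      q.coeff (e 1 0 1), q.coeff (e 0 1 1), q.coeff (e 0 0 2)⟩
      = .monomial (e 2 0 0) (q.coeff (e 2 0 0)) + .monomial (e 1 1 0) (q.coeff (e 1 1 0))
      + .monomial (e 0 2 0) (q.coeff (e 0 2 0)) + .monomial (e 1 0 1) (q.coeff (e 1 0 1))
      + .monomial (e 0 1 1) (q.coeff (e 0 1 1)) + .monomial (e 0 0 2) (q.coeff (e 0 0 2)) := by
    simp only [← hX, Quad.toMvPolynomial]
    ring
  rw [hsum]
  ext m
  simp only [MvPolynomial.coeff_add, MvPolynomial.coeff_monomial]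
  by_cases hm : m.degree = 2
  · have hm' : m 0 + m 1 + m 2 = 2 := by
      rwa [Finsupp.degree_eq_sum, Fin.sum_univ_three] at hm
    have hme : m = e (m 0) (m 1) (m 2) := ((he _ _ _ _).mpr ⟨rfl, rfl, rfl⟩).symm
    generalize m 0 = i, m 1 = j, m 2 = k at hm' hme
    subst hme
    have hi : i ≤ 2 := by omega
    have hj : j ≤ 2 := by omega
    obtain rfl : k = 2 - i - j := by omega
    interval_cases i <;> interval_cases j <;> first | omega | simp [he, e]
  · rw [hq.coeff_eq_zero hm]
    have hd (i j k : ℕ) (h : i + j + k = 2) : e i j k ≠ m := by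
      rintro rfl
      rw [Finsupp.degree_eq_sum, Fin.sum_univ_three] at hm
      exact hm h
    simp [hd]

/-- The cubic form `x³ + a₂ x² z + a₄ x z² + a₆ z³`. -/
noncomputable def cubicForm (W : WeierstrassCurve K) : MvPolynomial (Fin 2) K :=
  .X 0 ^ 3 + .C W.a₂ * (.X 0 * .X 0 * .X 1) + .C W.a₄ * (.X 0 * .X 1 * .X 1)
    + .C W.a₆ * (.X 1 * .X 1 * .X 1)

theorem isHomogeneous_cubicForm (W : WeierstrassCurve K) : (cubicForm W).IsHomogeneous 3 := by
  have h (i j k : Fin 2) (a : K) : (MvPolynomial.C a * (.X i * .X j * .X k)).IsHomogeneous 3 :=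
    (((MvPolynomial.isHomogeneous_X K i).mul (MvPolynomial.isHomogeneous_X K j)).mul
      (MvPolynomial.isHomogeneous_X K k)).C_mul a
  exact (((MvPolynomial.isHomogeneous_X_pow 0 3).add (h 0 0 1 _)).add (h 0 1 1 _)).add (h 1 1 1 _)

theorem exists_eq_cubicForm {f : MvPolynomial (Fin 2) K} (hf : f.IsHomogeneous 3)
    (h1 : f.coeff (Finsupp.single 0 3) = 1) :
    ∃ W : WeierstrassCurve K, W.IsCharNeTwoNF ∧ f = cubicForm W := by
  let e (i j : ℕ) : Fin 2 →₀ ℕ := Finsupp.equivFunOnFinite.symm ![i, j]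
  have he (m : Fin 2 →₀ ℕ) (i j : ℕ) : e i j = m ↔ i = m 0 ∧ j = m 1 := by
    simp [e, DFunLike.ext_iff, Fin.forall_fin_succ]
  have hX (i j : ℕ) (a : K) : MvPolynomial.C a * (.X 0 ^ i * .X 1 ^ j)
      = MvPolynomial.monomial (e i j) a := by
    rw [MvPolynomial.monomial_eq, Finsupp.prod_fintype _ _ (by simp)]
    simp [Fin.prod_univ_succ, e]
  have h1' : f.coeff (e 3 0) = 1 := by
    rw [← h1]
    congr 1
    rw [he]
    simp
  refine ⟨⟨0, f.coeff (e 2 1), 0, f.coeff (e 1 2), f.coeff (e 0 3)⟩, ⟨rfl, rfl⟩, ?_⟩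
  have hsum : cubicForm ⟨0, f.coeff (e 2 1), 0, f.coeff (e 1 2), f.coeff (e 0 3)⟩
      = .monomial (e 3 0) (f.coeff (e 3 0)) + .monomial (e 2 1) (f.coeff (e 2 1))
      + .monomial (e 1 2) (f.coeff (e 1 2)) + .monomial (e 0 3) (f.coeff (e 0 3)) := by
    simp only [← hX, cubicForm, h1', MvPolynomial.C_1]
    ring
  rw [hsum]
  ext m
  simp only [MvPolynomial.coeff_add, MvPolynomial.coeff_monomial]
  by_cases hm : m.degree = 3
  · have hm' : m 0 + m 1 = 3 := by
      rw [← hm, Finsupp.degree_eq_sum, Fin.sum_univ_two]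
    have hme : m = e (m 0) (m 1) := ((he _ _ _).mpr ⟨rfl, rfl⟩).symm
    generalize m 0 = i, m 1 = j at hm' hme
    subst hme
    have hi : i ≤ 3 := by omega
    obtain rfl : j = 3 - i := by omega
    interval_cases i <;> simp [he, e]
  · rw [hf.coeff_eq_zero hm]
    have hd (i j : ℕ) (h : i + j = 3) : e i j ≠ m := by
      rintro rfl
      rw [Finsupp.degree_eq_sum, Fin.sum_univ_two] at hm
      exact hm h
    simp [hd]

/-- The form with equations `y² z = x³ + a₂ x² z + a₄ x z² + a₆ z³` and `w² = q(x, y, z)`. -/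
noncomputable def stdForm (W : WeierstrassCurve K) (Q : Quad K) : Form K where
  f := cubicForm W
  f_homogeneous := isHomogeneous_cubicForm W
  f_monic := by
    have h (a : K) (i j k : Fin 2) (hk : k = 1) : (MvPolynomial.C a * (.X i * .X j * .X k)).coeff
        (Finsupp.single 0 3) = 0 := by
      subst hk
      rw [← mul_assoc, MvPolynomial.coeff_mul_X']
      simp
    rw [cubicForm, MvPolynomial.coeff_add, MvPolynomial.coeff_add, MvPolynomial.coeff_add,
      h _ _ _ _ rfl, h _ _ _ _ rfl, h _ _ _ _ rfl, MvPolynomial.coeff_X_pow]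
    simp
  q := Q.toMvPolynomial
  q_homogeneous := Q.isHomogeneous_toMvPolynomial

theorem exists_eq_stdForm (D : Form K) :
    ∃ (W : WeierstrassCurve K) (Q : Quad K), W.IsCharNeTwoNF ∧ D = stdForm W Q := by
  obtain ⟨f, hf, h1, q, hq⟩ := D
  obtain ⟨W, hW, rfl⟩ := exists_eq_cubicForm hf h1
  obtain ⟨Q, rfl⟩ := exists_eq_toMvPolynomial hq
  exact ⟨W, Q, hW, rfl⟩

/-- The value of `y² z - (x³ + a₂ x² z + a₄ x z² + a₆ z³)`. -/
def cubicValue (W : WeierstrassCurve K) (x y z : K) : K :=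
  y ^ 2 * z - (x ^ 3 + W.a₂ * (x * x * z) + W.a₄ * (x * z * z) + W.a₆ * (z * z * z))

variable (W : WeierstrassCurve K) (Q : Quad K)

theorem eval_cubic (v : Fin 3 → K) :
    MvPolynomial.eval v (stdForm W Q).cubic = cubicValue W (v 0) (v 1) (v 2) := by
  simp [Form.cubic, stdForm, cubicForm, cubicValue]

theorem eval_q (v : Fin 3 → K) :
    MvPolynomial.eval v (stdForm W Q).q = Q.value (v 0) (v 1) (v 2) := by
  simp [stdForm, Quad.toMvPolynomial, Quad.value]

theorem eval_P (v : Fin 4 → K) :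
    MvPolynomial.eval v (stdForm W Q).P = cubicValue W (v 0) (v 1) (v 2) := by
  rw [Form.P, MvPolynomial.eval_rename, eval_cubic]
  rfl

theorem eval_Q (v : Fin 4 → K) :
    MvPolynomial.eval v (stdForm W Q).Q = v 3 ^ 2 - Q.value (v 0) (v 1) (v 2) := by
  rw [Form.Q, map_sub, MvPolynomial.eval_rename, eval_q]
  simp

theorem jacobian_eq (v : Fin 4 → K) : (stdForm W Q).jacobian v =
    !![-(3 * v 0 ^ 2 + 2 * W.a₂ * v 0 * v 2 + W.a₄ * v 2 ^ 2), 2 * v 1 * v 2,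
      v 1 ^ 2 - (W.a₂ * v 0 ^ 2 + 2 * W.a₄ * v 0 * v 2 + 3 * W.a₆ * v 2 ^ 2), 0;
      -Q.dx (v 0) (v 1) (v 2), -Q.dy (v 0) (v 1) (v 2), -Q.dz (v 0) (v 1) (v 2), 2 * v 3] := by
  have hP : (stdForm W Q).P = .X 1 ^ 2 * .X 2 - (.X 0 ^ 3 + .C W.a₂ * (.X 0 * .X 0 * .X 2)
      + .C W.a₄ * (.X 0 * .X 2 * .X 2) + .C W.a₆ * (.X 2 * .X 2 * .X 2)) := by
    simp [Form.P, Form.cubic, stdForm, cubicForm]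
  have hQ : (stdForm W Q).Q = .X 3 ^ 2 - (.C Q.xx * .X 0 ^ 2 + .C Q.xy * (.X 0 * .X 1)
      + .C Q.yy * .X 1 ^ 2 + .C Q.xz * (.X 0 * .X 2) + .C Q.yz * (.X 1 * .X 2)
      + .C Q.zz * .X 2 ^ 2) := by
    simp [Form.Q, stdForm, Quad.toMvPolynomial]
  ext i j
  rw [Form.jacobian, Matrix.of_apply, hP, hQ]
  fin_cases i <;> fin_cases j <;>
    simp [MvPolynomial.pderiv_X, Quad.dx, Quad.dy, Quad.dz] <;> ring

/-- Linear independence of the two rows replaces minors, so each later argument only exhibits or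
excludes a relation with coefficients $\alpha,\beta$. -/
theorem rank_eq_two_iff (M : Matrix (Fin 2) (Fin 4) K) :
    M.rank = 2 ↔ ∀ α β : K, (∀ j, α * M 0 j + β * M 1 j = 0) → α = 0 ∧ β = 0 := by
  have h1 : M.rank = 2 ↔ LinearIndependent K M.row := by
    rw [linearIndependent_iff_card_eq_finrank_span, Matrix.rank_eq_finrank_span_row, Set.finrank,
      Fintype.card_fin, eq_comm]
  have h2 : M.row = ![M 0, M 1] := by
    ext i
    fin_cases i <;> rfl
  rw [h1, h2, LinearIndependent.pair_iff]
  simp only [funext_iff, Pi.add_apply, Pi.smul_apply, smul_eq_mul, Pi.zero_apply]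

end Forms

/-! ### Zero loci in the plane and in space -/

section Loci

variable {K : Type*} [Field K] (W : WeierstrassCurve K) (Q : Quad K)

theorem cubicValue_smul (a x y z : K) :
    cubicValue W (a * x) (a * y) (a * z) = a ^ 3 * cubicValue W x y z := by
  simp only [cubicValue]
  ring

theorem Quad.value_smul (a x y z : K) : Q.value (a * x) (a * y) (a * z) = a ^ 2 * Q.value x y z := by
  simp only [Quad.value]
  ring

/-- The representative chosen in `zeroLocus` differs from `v` by a unit, which homogeneity absorbs.
-/
theorem mk_mem_planeCubic {v : Fin 3 → K} (hv : v ≠ 0) :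
    Projectivization.mk K v hv ∈ (stdForm W Q).planeCubic ↔ cubicValue W (v 0) (v 1) (v 2) = 0 := by
  obtain ⟨a, ha⟩ := Projectivization.exists_smul_eq_mk_rep K v hv
  simp [Form.planeCubic, zeroLocus, ← ha, eval_cubic, Units.smul_def, cubicValue_smul]

theorem mk_mem_branchPoints {v : Fin 3 → K} (hv : v ≠ 0) :
    Projectivization.mk K v hv ∈ (stdForm W Q).branchPoints ↔
      cubicValue W (v 0) (v 1) (v 2) = 0 ∧ Q.value (v 0) (v 1) (v 2) = 0 := by
  obtain ⟨a, ha⟩ := Projectivization.exists_smul_eq_mk_rep K v hv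
  simp [Form.branchPoints, zeroLocus, ← ha, eval_cubic, eval_q, Units.smul_def, cubicValue_smul,
    Quad.value_smul]

theorem mk_mem_curve {v : Fin 4 → K} (hv : v ≠ 0) :
    Projectivization.mk K v hv ∈ (stdForm W Q).curve ↔
      cubicValue W (v 0) (v 1) (v 2) = 0 ∧ v 3 ^ 2 = Q.value (v 0) (v 1) (v 2) := by
  obtain ⟨a, ha⟩ := Projectivization.exists_smul_eq_mk_rep K v hv
  simp [Form.curve, zeroLocus, ← ha, eval_P, eval_Q, Units.smul_def, cubicValue_smul,
    Quad.value_smul, mul_pow, sub_eq_zero]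

theorem isNonsingular_iff : (stdForm W Q).IsNonsingular ↔ ∀ x y z w : K,
    ¬ (x = 0 ∧ y = 0 ∧ z = 0 ∧ w = 0) → cubicValue W x y z = 0 → w ^ 2 = Q.value x y z →
    ∀ α β : K,
      α * -(3 * x ^ 2 + 2 * W.a₂ * x * z + W.a₄ * z ^ 2) + β * -Q.dx x y z = 0 →
      α * (2 * y * z) + β * -Q.dy x y z = 0 →
      α * (y ^ 2 - (W.a₂ * x ^ 2 + 2 * W.a₄ * x * z + 3 * W.a₆ * z ^ 2)) + β * -Q.dz x y z = 0 →
      β * (2 * w) = 0 → α = 0 ∧ β = 0 := by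
  simp only [Form.IsNonsingular, rank_eq_two_iff, eval_P, eval_Q, jacobian_eq, sub_eq_zero]
  constructor
  · intro h x y z w hne hP hQ α β h0 h1 h2 h3
    refine h ![x, y, z, w] (fun e => hne ?_) hP hQ α β ?_
    · simpa [funext_iff, Fin.forall_fin_succ] using e
    · intro j
      fin_cases j
      exacts [h0, h1, h2, by simpa using h3]
  · intro h v hv hP hQ α β hj
    refine h (v 0) (v 1) (v 2) (v 3) (fun e => hv ?_) hP hQ α β (hj 0) (hj 1) (hj 2) ?_
    · simpa [funext_iff, Fin.forall_fin_succ] using e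
    · simpa using hj 3

theorem toPlane_zero : toPlane (0 : W.toAffine.Point)
    = Projectivization.mk K ![0, 1, 0] fun h => one_ne_zero (congrFun h 1) := rfl

theorem toPlane_some {x y : K} (h : W.toAffine.Nonsingular x y) : toPlane (.some x y h)
    = Projectivization.mk K ![x, y, 1] fun h => one_ne_zero (congrFun h 2) := rfl

theorem toPlane_injective : Function.Injective (toPlane (E := W)) := by
  rintro (_ | ⟨x, y, h⟩) (_ | ⟨x', y', h'⟩) e
  · rfl
  · obtain ⟨a, ha⟩ := (Projectivization.mk_eq_mk_iff' ..).mp e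
    have h0 := congrFun ha 1
    have h2 := congrFun ha 2
    simp at h0 h2
    simp [h2] at h0
  · obtain ⟨a, ha⟩ := (Projectivization.mk_eq_mk_iff' ..).mp e
    simpa using congrFun ha 2
  · obtain ⟨a, ha⟩ := (Projectivization.mk_eq_mk_iff' ..).mp e
    have h0 := congrFun ha 0
    have h1 := congrFun ha 1
    have h2 := congrFun ha 2
    simp at h0 h1 h2
    simp only [h2, one_mul] at h0 h1
    subst h0 h1
    rfl

variable {W}

theorem equation_iff_cubicValue (hW : W.IsCharNeTwoNF) {x y : K} :
    W.toAffine.Equation x y ↔ cubicValue W x y 1 = 0 := by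
  rw [equation_iff]
  simp only [W.a₁_of_isCharNeTwoNF, W.a₃_of_isCharNeTwoNF, cubicValue]
  rw [← sub_eq_zero]
  ring_nf

theorem nonsingular_iff_of_isCharNeTwoNF (hW : W.IsCharNeTwoNF) {x y : K} :
    W.toAffine.Nonsingular x y ↔ cubicValue W x y 1 = 0 ∧
      (3 * x ^ 2 + 2 * W.a₂ * x + W.a₄ ≠ 0 ∨ 2 * y ≠ 0) := by
  rw [nonsingular_iff', equation_iff_cubicValue hW]
  simp only [W.a₁_of_isCharNeTwoNF, W.a₃_of_isCharNeTwoNF, zero_mul, zero_sub, add_zero, ne_eq,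
    neg_eq_zero]

theorem eq_zero_of_cubicValue_zero {x y : K} (h : cubicValue W x y 0 = 0) : x = 0 := by
  simpa [cubicValue] using h

/-- Every point of the plane cubic is the point at infinity or an affine point. -/
theorem range_toPlane (hW : W.IsCharNeTwoNF)
    (hns : ∀ x y, W.toAffine.Equation x y → W.toAffine.Nonsingular x y) :
    Set.range (toPlane (E := W)) = (stdForm W Q).planeCubic := by
  ext p
  constructor
  · rintro ⟨_ | ⟨x, y, h⟩, rfl⟩
    · exact (mk_mem_planeCubic W Q _).mpr (by simp [cubicValue])
    · exact (mk_mem_planeCubic W Q _).mpr (by simpa using (equation_iff_cubicValue hW).mp h.1)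
  · induction p with | h v hv => ?_
    rw [mk_mem_planeCubic]
    intro h
    by_cases hz : v 2 = 0
    · rw [hz] at h
      have hx := eq_zero_of_cubicValue_zero h
      refine ⟨0, ?_⟩
      rw [toPlane_zero, eq_comm, Projectivization.mk_eq_mk_iff']
      refine ⟨v 1, ?_⟩
      ext i
      fin_cases i <;> simp [hx, hz]
    · have he : cubicValue W (v 0 / v 2) (v 1 / v 2) 1 = 0 := by
        have h3 := cubicValue_smul W (v 2) (v 0 / v 2) (v 1 / v 2) 1
        rw [mul_div_cancel₀ _ hz, mul_div_cancel₀ _ hz, mul_one, h] at h3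
        simpa [hz] using h3.symm
      refine ⟨.some _ _ (hns _ _ ((equation_iff_cubicValue hW).mpr he)), ?_⟩
      rw [toPlane_some, eq_comm, Projectivization.mk_eq_mk_iff']
      refine ⟨v 2, ?_⟩
      ext i
      fin_cases i <;> simp [mul_div_cancel₀ _ hz]

/-- The restriction of a quadratic form to the affine curve. -/
noncomputable def Quad.toCoord (W : WeierstrassCurve.Affine K) (Q : Quad K) : W.CoordinateRing :=
  algebraMap K _ Q.xx * xCoord W ^ 2 + algebraMap K _ Q.xy * (xCoord W * yCoord W)
    + algebraMap K _ Q.yy * yCoord W ^ 2 + algebraMap K _ Q.xz * xCoord W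
    + algebraMap K _ Q.yz * yCoord W + algebraMap K _ Q.zz

theorem evalAt_toCoord {x y : K} (h : W.toAffine.Equation x y) :
    evalAt h (Q.toCoord W.toAffine) = Q.value x y 1 := by
  simp [Quad.toCoord, Quad.value]

/-- The value of the form at $(0:1:0)$ is its $y^2$-coefficient, so `yy` decides whether $O$ is a
branch point. -/
theorem toPlane_mem_branchPoints_iff (hW : W.IsCharNeTwoNF) (P : W.toAffine.Point) :
    toPlane P ∈ (stdForm W Q).branchPoints ↔
      (P = 0 ∧ Q.yy = 0) ∨ (P ≠ 0 ∧ Q.toCoord W.toAffine ∈ pointIdeal P) := by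
  rcases P with _ | ⟨x, y, h⟩
  · refine (mk_mem_branchPoints W Q _).trans ?_
    simp [cubicValue, Quad.value, ← Point.zero_def]
  · refine (mk_mem_branchPoints W Q _).trans ?_
    have := (equation_iff_cubicValue hW).mp h.1
    simp [this, pointIdeal, mem_XYIdeal_iff h.1, evalAt_toCoord]

end Loci

/-! ### Nonsingularity of the space curve as transversality -/

section Transversality

variable {K : Type*} [Field K] {W : WeierstrassCurve K} {Q : Quad K}

/-- The conic `q = 0` meets the plane cubic `W` transversally. -/
structure IsTransversal (W : WeierstrassCurve K) (Q : Quad K) : Prop where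
  affine : ∀ x y, cubicValue W x y 1 = 0 → Q.value x y 1 = 0 →
    2 * y * Q.dx x y 1 + (3 * x ^ 2 + 2 * W.a₂ * x + W.a₄) * Q.dy x y 1 ≠ 0
  infinity : Q.yy = 0 → Q.xy ≠ 0

/-- Algebraic closedness provides a point of the space curve above any point of the cubic. Above a
singular point the first Jacobian row would vanish: its $z$-entry follows from the other two by
Euler's relation. -/
theorem nonsingular_of_isNonsingular [IsAlgClosed K] (hW : W.IsCharNeTwoNF)
    (h : (stdForm W Q).IsNonsingular) (x y : K) (he : W.toAffine.Equation x y) :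
    W.toAffine.Nonsingular x y := by
  have hP := (equation_iff_cubicValue hW).mp he
  refine (nonsingular_iff_of_isCharNeTwoNF hW).mpr ⟨hP, ?_⟩
  by_contra! hn
  obtain ⟨hx, hy⟩ := hn
  obtain ⟨w, hw⟩ := IsAlgClosed.exists_pow_nat_eq (Q.value x y 1) two_pos
  refine one_ne_zero (((isNonsingular_iff W Q).mp h x y 1 w (by simp) hP hw 1 0 ?_ ?_ ?_ ?_).1)
  · linear_combination -hx
  · linear_combination hy
  · simp only [cubicValue] at hP
    linear_combination 3 * hP - y * hy + x * hx
  · ring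

/-- At a branch point $w=0$ kills the last column. The affine expression is the derivative of $q$
along the tangent direction $(2y,f'(x))$; if it vanishes, the rows are dependent in the $x$- and
$y$-columns, and by Euler's relation in the $z$-column. -/
theorem isTransversal_of_isNonsingular [IsAlgClosed K] (hW : W.IsCharNeTwoNF)
    (h : (stdForm W Q).IsNonsingular) : IsTransversal W Q := by
  have hns := nonsingular_of_isNonsingular hW h
  rw [isNonsingular_iff] at h
  constructor
  · intro x y hP hQ h0
    have hxy := ((nonsingular_iff_of_isCharNeTwoNF hW).mp
      (hns x y ((equation_iff_cubicValue hW).mpr hP))).2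
    have key (α β : K) (h1 : α * (3 * x ^ 2 + 2 * W.a₂ * x + W.a₄) + β * Q.dx x y 1 = 0)
        (h2 : α * (2 * y) = β * Q.dy x y 1) : β = 0 := by
      refine (h x y 1 0 (by simp) hP (by simp [hQ]) α β ?_ ?_ ?_ ?_).2
      · linear_combination -h1
      · linear_combination h2
      · simp only [cubicValue] at hP
        simp only [Quad.value, Quad.dx, Quad.dy, Quad.dz] at hQ h1 h2 ⊢
        linear_combination 3 * α * hP - 2 * β * hQ - y * h2 + x * h1
      · ring
    rcases hxy with hx | hy
    · exact hx (neg_eq_zero.mp (key (Q.dx x y 1) (-(3 * x ^ 2 + 2 * W.a₂ * x + W.a₄)) (by ring)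
        (by linear_combination h0)))
    · exact hy (key (Q.dy x y 1) (2 * y) (by linear_combination h0) (by ring))
  · intro hyy hxy
    -- At $(0:1:0:0)$ the gradient of the cubic is $(0,0,1)$ and that of $q$ is $(0,0,$`yz`$)$,
    -- whence the relation with $\alpha=$ `yz`, $\beta=1$.
    refine one_ne_zero (h 0 1 0 0 (by simp) (by simp [cubicValue]) (by simp [Quad.value, hyy])
      Q.yz 1 ?_ ?_ ?_ ?_).2 <;> simp [Quad.dx, Quad.dy, Quad.dz, hyy, hxy]

/-- For a relation between the rows, $\beta=0$ follows from the entry $2w$ or from transversality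
(at infinity, from the $x$- or $y$-column); then $\alpha=0$ because the cubic is smooth. -/
theorem isNonsingular_of_isTransversal (hK : (2 : K) ≠ 0) (hW : W.IsCharNeTwoNF)
    (hns : ∀ x y, W.toAffine.Equation x y → W.toAffine.Nonsingular x y) (h : IsTransversal W Q) :
    (stdForm W Q).IsNonsingular := by
  rw [isNonsingular_iff]
  intro x y z w hne hP hQ α β h0 h1 h2 h3
  by_cases hz : z = 0
  · subst hz
    obtain rfl := eq_zero_of_cubicValue_zero hP
    have hy : y ≠ 0 := by
      rintro rfl
      refine hne ⟨rfl, rfl, rfl, ?_⟩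
      simpa [Quad.value] using hQ
    have hβ : β = 0 := by
      simp only [Quad.dx, Quad.dy] at h0 h1
      by_cases hyy : Q.yy = 0
      · have := h.infinity hyy
        simpa [hy, this] using h0
      · simpa [hy, hyy, hK] using h1
    subst hβ
    simpa [hy] using h2
  · obtain ⟨x, rfl⟩ : ∃ x', x = z * x' := ⟨x / z, (mul_div_cancel₀ _ hz).symm⟩
    obtain ⟨y, rfl⟩ : ∃ y', y = z * y' := ⟨y / z, (mul_div_cancel₀ _ hz).symm⟩
    have hP' : cubicValue W x y 1 = 0 := by
      have := cubicValue_smul W z x y 1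
      rw [mul_one, hP] at this
      simpa [hz] using this.symm
    have e0 : α * z * (3 * x ^ 2 + 2 * W.a₂ * x + W.a₄) + β * Q.dx x y 1 = 0 := by
      refine mul_left_cancel₀ hz ?_
      simp only [Quad.dx] at h0 ⊢
      linear_combination -h0
    have e1 : α * z * (2 * y) - β * Q.dy x y 1 = 0 := by
      refine mul_left_cancel₀ hz ?_
      simp only [Quad.dy] at h1 ⊢
      linear_combination h1
    have hβ : β = 0 := by
      by_cases hw : w = 0
      · have hQ' : Q.value x y 1 = 0 := by
          have := Q.value_smul z x y 1
          rw [mul_one, ← hQ, hw] at this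
          simpa [hz] using this.symm
        refine (mul_eq_zero.mp ?_).resolve_right (h.affine x y hP' hQ')
        linear_combination 2 * y * e0 - (3 * x ^ 2 + 2 * W.a₂ * x + W.a₄) * e1
      · simpa [hw, hK] using h3
    subst hβ
    refine ⟨?_, rfl⟩
    rcases ((nonsingular_iff_of_isCharNeTwoNF hW).mp
      (hns x y ((equation_iff_cubicValue hW).mpr hP'))).2 with hx | hy
    · simpa [hz, hx] using e0
    · have : α * z * (2 * y) = 0 := by linear_combination e1
      simpa only [mul_eq_zero, hz, hy, or_false, false_or] using! (mul_eq_zero.mp this).resolve_right hy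

/-- A Weierstrass curve without singular affine points is elliptic. -/
theorem isElliptic_of_nonsingular [IsAlgClosed K] (hK : (2 : K) ≠ 0) (hW : W.IsCharNeTwoNF)
    (hns : ∀ x y, W.toAffine.Equation x y → W.toAffine.Nonsingular x y) : W.IsElliptic := by
  refine ⟨isUnit_iff_ne_zero.mpr fun hΔ => ?_⟩
  have h4 : (4 : K) ≠ 0 := by
    have : (4 : K) = 2 * 2 := by norm_num
    rw [this]
    exact mul_ne_zero hK hK
  -- In normal form the 2-torsion polynomial is $4f$. If $\Delta=0$ it has a double root $x$, and
  -- $(x,0)$ is a singular point.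
  have hd : W.twoTorsionPolynomial.discr = 0 := by
    rw [W.twoTorsionPolynomial_discr, hΔ, mul_zero]
  have hnd := (Cubic.discr_ne_zero_iff_roots_nodup (P := W.twoTorsionPolynomial)
    (φ := RingHom.id K) h4 (IsAlgClosed.splits _)).not.mp (not_not.mpr hd)
  rw [Cubic.map_roots, Polynomial.map_id] at hnd
  set p := W.twoTorsionPolynomial.toPoly with hp
  have hp0 : p ≠ 0 := Cubic.ne_zero_of_a_ne_zero h4
  obtain ⟨x, hx⟩ : ∃ x, 1 < p.rootMultiplicity x := by
    by_contra! hle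
    classical
    exact hnd (Multiset.nodup_iff_count_le_one.mpr fun a => by rw [count_roots]; exact hle a)
  obtain ⟨hr, hr'⟩ := (one_lt_rootMultiplicity_iff_isRoot hp0).mp hx
  simp [hp, Cubic.toPoly, WeierstrassCurve.twoTorsionPolynomial, IsRoot.def] at hr hr'
  have hP : cubicValue W x 0 1 = 0 := by
    refine mul_left_cancel₀ h4 ?_
    simp only [cubicValue]
    linear_combination -hr
  rcases ((nonsingular_iff_of_isCharNeTwoNF hW).mp
    (hns x 0 ((equation_iff_cubicValue hW).mpr hP))).2 with h | h
  · refine h (mul_left_cancel₀ h4 ?_)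
    linear_combination hr'
  · simp at h

/-- At a transversal zero the ideal of the point is generated by the quadratic form and the square
of the ideal. -/
theorem pointIdeal_le_of_isTransversal (hW : W.IsCharNeTwoNF) (h : IsTransversal W Q)
    {P : W.toAffine.Point} (hP : P ≠ 0) (hQ : Q.toCoord W.toAffine ∈ pointIdeal P) :
    pointIdeal P ≤ Ideal.span {Q.toCoord W.toAffine} ⊔ pointIdeal P ^ 2 := by
  rcases P with _ | ⟨x, y, hxy⟩
  · exact absurd rfl hP
  have hc := (equation_iff_cubicValue hW).mp hxy.1
  have hq : Q.value x y 1 = 0 := by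
    rw [← evalAt_toCoord Q hxy.1]
    exact (mem_XYIdeal_iff hxy.1 _).mp hQ
  have hδ := h.affine x y hc hq
  set δ := 2 * y * Q.dx x y 1 + (3 * x ^ 2 + 2 * W.a₂ * x + W.a₄) * Q.dy x y 1 with hδ_def
  set I := Ideal.span {Q.toCoord W.toAffine} ⊔ pointIdeal (.some x y hxy) ^ 2 with hI
  let c := algebraMap K W.toAffine.CoordinateRing
  let u := xCoord W.toAffine - c x
  let v := yCoord W.toAffine - c y
  have hspan : pointIdeal (.some x y hxy) = Ideal.span {u, v} := XYIdeal_eq_span x y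
  have hu : u ∈ pointIdeal (.some x y hxy) := hspan ▸ Ideal.subset_span (by simp)
  have hv : v ∈ pointIdeal (.some x y hxy) := hspan ▸ Ideal.subset_span (by simp)
  have hsq {a b} (ha : a ∈ pointIdeal (.some x y hxy)) (hb : b ∈ pointIdeal (.some x y hxy)) :
      a * b ∈ I := Ideal.mem_sup_right (by rw [pow_two]; exact Ideal.mul_mem_mul ha hb)
  have huu := hsq hu hu
  have huv := hsq hu hv
  have hvv := hsq hv hv
  -- Modulo the square of the point ideal, the curve and the conic give two linear relations between
  -- $u$ and $v$. Their determinant is $\delta\neq0$ up to sign, so Cramer's rule puts $u$ and $v$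
  -- in $I$.
  have h1 : c (2 * y) * v - c (3 * x ^ 2 + 2 * W.a₂ * x + W.a₄) * u ∈ I := by
    have : c (2 * y) * v - c (3 * x ^ 2 + 2 * W.a₂ * x + W.a₄) * u
        = (u + c (3 * x + W.a₂)) * (u * u) - v * v := by
      have e := coord_equation (W := W.toAffine)
      have e' := congrArg c hc
      simp only [W.a₁_of_isCharNeTwoNF, W.a₃_of_isCharNeTwoNF, map_zero] at e
      simp only [cubicValue, map_sub, map_add, map_mul, map_pow, map_zero, map_one] at e'
      simp only [u, v, map_add, map_mul, map_pow, map_ofNat]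
      simp only [c] at *
      linear_combination e - e'
    rw [this]
    exact sub_mem (I.mul_mem_left _ huu) hvv
  have h2 : c (Q.dx x y 1) * u + c (Q.dy x y 1) * v ∈ I := by
    have : c (Q.dx x y 1) * u + c (Q.dy x y 1) * v = Q.toCoord W.toAffine
        - (c Q.xx * (u * u) + c Q.xy * (u * v) + c Q.yy * (v * v)) := by
      have e' := congrArg c hq
      simp only [Quad.value, map_add, map_mul, map_pow, map_zero, map_one] at e'
      simp only [u, v, Quad.toCoord, Quad.dx, Quad.dy, map_add, map_mul, map_ofNat, map_one]
      simp only [c] at *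
      linear_combination -e'
    rw [this]
    exact sub_mem (Ideal.mem_sup_left (Ideal.mem_span_singleton_self _))
      (add_mem (add_mem (I.mul_mem_left _ huu) (I.mul_mem_left _ huv)) (I.mul_mem_left _ hvv))
  have hunit (a) (ha : c δ * a ∈ I) : a ∈ I := by
    have := I.mul_mem_left (c δ⁻¹) ha
    rwa [← mul_assoc, ← map_mul, inv_mul_cancel₀ hδ, map_one, one_mul] at this
  rw [hspan, Ideal.span_le]
  rintro _ (rfl | rfl)
  · refine hunit _ ?_
    convert! sub_mem (I.mul_mem_left (c (2 * y)) h2) (I.mul_mem_left (c (Q.dy x y 1)) h1) using 1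
    rw [hδ_def, map_add, map_mul c (2 * y), map_mul c (3 * x ^ 2 + 2 * W.a₂ * x + W.a₄)]
    ring
  · refine hunit _ ?_
    convert! add_mem (I.mul_mem_left (c (Q.dx x y 1)) h1)
      (I.mul_mem_left (c (3 * x ^ 2 + 2 * W.a₂ * x + W.a₄)) h2) using 1
    rw [hδ_def, map_add, map_mul c (2 * y), map_mul c (3 * x ^ 2 + 2 * W.a₂ * x + W.a₄)]
    ring

/-- If the zeros of a quadratic form are simple, then the intersection is transversal. -/
theorem affine_transversal_of_prod_eq_span (hW : W.IsCharNeTwoNF) {S : Finset W.toAffine.Point}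
    (hS : ∏ P ∈ S, pointIdeal P = Ideal.span {Q.toCoord W.toAffine}) {x y : K}
    (hxy : W.toAffine.Nonsingular x y) (hP : .some x y hxy ∈ S) :
    2 * y * Q.dx x y 1 + (3 * x ^ 2 + 2 * W.a₂ * x + W.a₄) * Q.dy x y 1 ≠ 0 := by
  intro h0
  obtain ⟨hc, hne⟩ := (nonsingular_iff_of_isCharNeTwoNF hW).mp hxy
  have hq : Q.value x y 1 = 0 := by
    rw [← evalAt_toCoord Q hxy.1, ← mem_XYIdeal_iff]
    exact mem_prod_pointIdeal.mp (hS ▸ Ideal.mem_span_singleton_self _) _ hP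
  let ε : DualNumber K := DualNumber.eps
  have hε : ε * ε = 0 := DualNumber.eps_mul_eps
  let c := algebraMap K (DualNumber K)
  -- The tangent vector $(2y,f'(x))$ is a point of the curve over the dual numbers. If the
  -- derivative of $q$ along it vanishes, so does $q$; then the tangent vector is zero, against
  -- smoothness.
  have he : (c y + (3 * x ^ 2 + 2 * W.a₂ * x + W.a₄) • ε) ^ 2
      + c W.a₁ * (c x + (2 * y) • ε) * (c y + (3 * x ^ 2 + 2 * W.a₂ * x + W.a₄) • ε)
      + c W.a₃ * (c y + (3 * x ^ 2 + 2 * W.a₂ * x + W.a₄) • ε)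
      = (c x + (2 * y) • ε) ^ 3 + c W.a₂ * (c x + (2 * y) • ε) ^ 2
      + c W.a₄ * (c x + (2 * y) • ε) + c W.a₆ := by
    have e' := congrArg c hc
    simp only [cubicValue, map_sub, map_add, map_mul, map_pow, map_zero, map_one] at e'
    simp only [W.a₁_of_isCharNeTwoNF, W.a₃_of_isCharNeTwoNF, map_zero, Algebra.smul_def, map_add,
      map_mul, map_pow, map_ofNat]
    simp only [c] at *
    generalize algebraMap K (DualNumber K) = c at *
    linear_combination e' + ((3 * c x ^ 2 + 2 * c W.a₂ * c x + c W.a₄) ^ 2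
      - (3 * c x + c W.a₂) * (4 * c y ^ 2) - 8 * c y ^ 3 * ε) * hε
  have hφ : coordHom (W := W.toAffine) _ _ he (Q.toCoord W.toAffine) = 0 := by
    have e' := congrArg c hq
    have e'' := congrArg c h0
    simp only [Quad.value, Quad.dx, Quad.dy, map_add, map_mul, map_pow, map_zero, map_one,
      map_ofNat] at e' e''
    simp only [Quad.toCoord, map_add, map_mul, map_pow, AlgHom.commutes, coordHom_xCoord,
      coordHom_yCoord, Algebra.smul_def, map_ofNat]
    simp only [c] at *
    generalize algebraMap K (DualNumber K) = c at *
    generalize 3 * c x ^ 2 + 2 * c W.a₂ * c x + c W.a₄ = F at *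
    linear_combination e' + ε * e'' + (c Q.xx * (2 * c y) ^ 2 + c Q.xy * (2 * c y) * F
      + c Q.yy * F ^ 2) * hε
  have := tangent_eq_zero hxy hP hS _ (coordHom_xCoord he) (coordHom_yCoord he) hφ
  tauto

end Transversality

/-! ### Quadratic forms as functions with pole order at most six -/

section NormDegree

variable {K : Type*} [Field K]

/-- The function $x$ has a pole of order 2 at $O$ and $y$ one of order 3. The contributions of $p$
and $qy$ have different parity, so they cannot cancel. The case $q=0$ is separate because
`natDegree` of zero is 0, which would contribute 3. -/
theorem natDegree_norm {W : WeierstrassCurve.Affine K} (p q : K[X]) [Decidable (q = 0)] :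
    (Algebra.norm K[X] (aeval (xCoord W) p + aeval (xCoord W) q * yCoord W)).natDegree
      = max (2 * p.natDegree) (if q = 0 then 0 else 2 * q.natDegree + 3) := by
  refine (congrArg (fun r => (Algebra.norm K[X] r).natDegree) (aeval_add_eq_smul_basis p q)).trans ?_
  rw [natDegree, CoordinateRing.degree_norm_smul_basis]
  by_cases hp : p = 0 <;> by_cases hq : q = 0
  · simp [hp, hq]
  · rw [if_neg hq, hp, degree_eq_natDegree hq]
    simp only [degree_zero, natDegree_zero, mul_zero, zero_le, max_eq_right]
    rw [two_nsmul, WithBot.bot_add, max_eq_right bot_le]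
    rfl
  · rw [if_pos hq, hq, degree_eq_natDegree hp]
    simp only [degree_zero, zero_le, max_eq_left]
    rw [two_nsmul (⊥ : WithBot ℕ), WithBot.bot_add, WithBot.bot_add, max_eq_left bot_le]
    rfl
  · rw [if_neg hq, degree_eq_natDegree hp, degree_eq_natDegree hq]
    rfl

namespace Quad

variable (Q : Quad K) (W : WeierstrassCurve K)

/-- The part of the restriction of a quadratic form to the affine curve that does not
involve `y`. -/
noncomputable def evenPart : K[X] :=
  C Q.yy * X ^ 3 + C (Q.yy * W.a₂ + Q.xx) * X ^ 2 + C (Q.yy * W.a₄ + Q.xz) * X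
    + C (Q.yy * W.a₆ + Q.zz)

/-- The coefficient of `y` in the restriction of a quadratic form to the affine curve. -/
noncomputable def oddPart : K[X] := C Q.xy * X + C Q.yz

variable {W}

theorem toCoord_eq (hW : W.IsCharNeTwoNF) : Q.toCoord W.toAffine =
    aeval (xCoord W.toAffine) (Q.evenPart W) + aeval (xCoord W.toAffine) Q.oddPart * yCoord _ := by
  have e := coord_equation (W := W.toAffine)
  simp only [W.a₁_of_isCharNeTwoNF, W.a₃_of_isCharNeTwoNF, map_zero] at e
  simp only [toCoord, evenPart, oddPart, map_add, map_mul, map_pow, aeval_C, aeval_X]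
  linear_combination algebraMap K _ Q.yy * e

theorem natDegree_norm_toCoord_le [DecidableEq K] (hW : W.IsCharNeTwoNF) :
    (Algebra.norm K[X] (Q.toCoord W.toAffine)).natDegree ≤ if Q.yy = 0 then 5 else 6 := by
  classical
  rw [Q.toCoord_eq hW, natDegree_norm]
  have hq : Q.oddPart.natDegree ≤ 1 := natDegree_linear_le
  have hq' : (if Q.oddPart = 0 then 0 else 2 * Q.oddPart.natDegree + 3) ≤ 5 := by
    split_ifs <;> omega
  by_cases hyy : Q.yy = 0
  · rw [if_pos hyy]
    have : (Q.evenPart W).natDegree ≤ 2 := by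
      rw [evenPart, hyy, C_0, zero_mul, zero_add]
      exact natDegree_quadratic_le
    exact max_le (by omega) hq'
  · rw [if_neg hyy]
    have : (Q.evenPart W).natDegree ≤ 3 := natDegree_cubic_le
    exact max_le (by omega) (hq'.trans (by norm_num))

theorem natDegree_norm_toCoord [DecidableEq K] (hW : W.IsCharNeTwoNF) (h : Q.yy = 0 → Q.xy ≠ 0) :
    (Algebra.norm K[X] (Q.toCoord W.toAffine)).natDegree = if Q.yy = 0 then 5 else 6 := by
  classical
  refine (Q.natDegree_norm_toCoord_le hW).antisymm ?_
  rw [Q.toCoord_eq hW, natDegree_norm]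
  split_ifs with hyy h0 h0
  · refine absurd ?_ (h hyy)
    simpa [oddPart] using congrArg (coeff · 1) h0
  · have : Q.oddPart.natDegree = 1 := natDegree_linear (h hyy)
    rw [this]
    exact le_max_right _ _
  all_goals
    have : (Q.evenPart W).natDegree = 3 := natDegree_cubic hyy
    rw [this]
    exact le_max_left _ _

/-- No nonzero quadratic form vanishes on the cubic. The $X^3$-coefficient of `evenPart` gives `yy`
first, as `yy` enters the other coefficients. -/
theorem toCoord_injective (hW : W.IsCharNeTwoNF) {Q Q' : Quad K}
    (h : Q.toCoord W.toAffine = Q'.toCoord W.toAffine) : Q = Q' := by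
  rw [Q.toCoord_eq hW, Q'.toCoord_eq hW] at h
  have h' : aeval (xCoord W.toAffine) (Q.evenPart W - Q'.evenPart W)
      + aeval (xCoord W.toAffine) (Q.oddPart - Q'.oddPart) * yCoord _ = 0 := by
    rw [map_sub, map_sub]
    linear_combination h
  obtain ⟨hp, hq⟩ := CoordinateRing.smul_basis_eq_zero ((aeval_add_eq_smul_basis _ _).symm.trans h')
  rw [sub_eq_zero] at hp hq
  have hp' := (Cubic.toPoly_injective ⟨_, _, _, _⟩ ⟨_, _, _, _⟩).mp hp
  have hq' := (Cubic.toPoly_injective ⟨0, 0, Q.xy, Q.yz⟩ ⟨0, 0, Q'.xy, Q'.yz⟩).mp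
    (by simpa [Cubic.toPoly, oddPart] using hq)
  simp only [Cubic.mk.injEq] at hp' hq'
  obtain ⟨h3, h2, h1, h0⟩ := hp'
  replace h3 : Q.yy = Q'.yy := h3
  rw [h3] at h0 h1 h2
  ext
  exacts [add_left_cancel h2, hq'.2.2.1, h3, add_left_cancel h1, hq'.2.2.2, add_left_cancel h0]

/-- The degree bounds describe the functions with pole order at most 6. The witness writes $x^3$ as
$y^2-a_2x^2-a_4x-a_6$. -/
theorem exists_eq_toCoord (hW : W.IsCharNeTwoNF) {p q : K[X]} (hp : p.natDegree ≤ 3)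
    (hq : q.natDegree ≤ 1) : ∃ Q : Quad K, Q.yy = p.coeff 3 ∧ Q.xy = q.coeff 1 ∧
      aeval (xCoord W.toAffine) p + aeval (xCoord W.toAffine) q * yCoord _
        = Q.toCoord W.toAffine := by
  refine ⟨⟨p.coeff 2 - p.coeff 3 * W.a₂, q.coeff 1, p.coeff 3, p.coeff 1 - p.coeff 3 * W.a₄,
    q.coeff 0, p.coeff 0 - p.coeff 3 * W.a₆⟩, rfl, rfl, ?_⟩
  rw [toCoord_eq _ hW]
  congr 3
  · rw [evenPart, p.as_sum_range' 4 (by omega)]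
    simp [Finset.sum_range_succ, ← C_mul_X_pow_eq_monomial]
    ring
  · rw [oddPart, q.as_sum_range' 2 (by omega)]
    simp [Finset.sum_range_succ, ← C_mul_X_pow_eq_monomial]
    ring_nf

/-- The multiple of a quadratic form by a scalar. -/
def scale (c : K) (Q : Quad K) : Quad K :=
  ⟨c * Q.xx, c * Q.xy, c * Q.yy, c * Q.xz, c * Q.yz, c * Q.zz⟩

theorem toMvPolynomial_scale (c : K) :
    (Q.scale c).toMvPolynomial = MvPolynomial.C c * Q.toMvPolynomial := by
  simp only [scale, toMvPolynomial, map_mul]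
  ring

theorem toCoord_scale (c : K) (W : WeierstrassCurve.Affine K) :
    (Q.scale c).toCoord W = algebraMap K _ c * Q.toCoord W := by
  simp only [scale, toCoord, map_mul]
  ring

theorem toCoord_zero (W : WeierstrassCurve.Affine K) :
    toCoord W ⟨0, 0, 0, 0, 0, 0⟩ = 0 := by
  simp [toCoord]

theorem toCoord_ne_zero (hW : W.IsCharNeTwoNF) (h : Q.yy = 0 → Q.xy ≠ 0) :
    Q.toCoord W.toAffine ≠ 0 := by
  intro h0
  obtain rfl := toCoord_injective hW (h0.trans (toCoord_zero _).symm)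
  exact h rfl rfl

end Quad

end NormDegree

/-! ### From conics to six points and back -/

section Correspondence

variable {K : Type*} [Field K] {W : WeierstrassCurve K} {Q : Quad K}

/-- The affine intersection points of a transversal conic, with the factorization of the
ideal. -/
theorem exists_affine_zeros [IsAlgClosed K] [DecidableEq K] (hW : W.IsCharNeTwoNF)
    (hns : ∀ x y, W.toAffine.Equation x y → W.toAffine.Nonsingular x y) (h : IsTransversal W Q) :
    ∃ S : Finset W.toAffine.Point, 0 ∉ S ∧
      (∀ P : W.toAffine.Point, P ≠ 0 → (P ∈ S ↔ Q.toCoord W.toAffine ∈ pointIdeal P)) ∧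
      ∏ P ∈ S, pointIdeal P = Ideal.span {Q.toCoord W.toAffine} ∧
      S.card = if Q.yy = 0 then 5 else 6 := by
  have hr := Q.toCoord_ne_zero hW h.infinity
  have hfin := finite_zeros hr
  have hmem (P) : P ∈ hfin.toFinset ↔ P ≠ 0 ∧ Q.toCoord W.toAffine ∈ pointIdeal P := by simp
  have hprod : ∏ P ∈ hfin.toFinset, pointIdeal P = Ideal.span {Q.toCoord W.toAffine} :=
    prod_pointIdeal_eq_span hns (fun P hP => (hmem P).trans (and_iff_right hP))
      (fun P hP => pointIdeal_le_of_isTransversal hW h ((hmem P).mp hP).1 ((hmem P).mp hP).2)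
      (by simp)
  refine ⟨hfin.toFinset, by simp, fun P hP => (hmem P).trans (and_iff_right hP), hprod, ?_⟩
  rw [← natDegree_norm_eq_card (fun P hP => ((hmem P).mp hP).1) hr hprod,
    Q.natDegree_norm_toCoord hW h.infinity]

/-- A transversal conic meets the cubic in six points with sum zero. -/
theorem exists_six_points [IsAlgClosed K] [DecidableEq K] (hW : W.IsCharNeTwoNF)
    (hns : ∀ x y, W.toAffine.Equation x y → W.toAffine.Nonsingular x y) (h : IsTransversal W Q) :
    ∃ S : Finset W.toAffine.Point, S.card = 6 ∧ ∑ P ∈ S, P = 0 ∧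
      toPlane '' (S : Set W.toAffine.Point) = (stdForm W Q).branchPoints := by
  obtain ⟨S, h0, hmem, hprod, hcard⟩ := exists_affine_zeros hW hns h
  have hsum : ∑ P ∈ S, P = 0 :=
    (sum_eq_zero_iff S).mpr ⟨_, Q.toCoord_ne_zero hW h.infinity, hprod⟩
  have himage (T : Finset W.toAffine.Point) (hT : ∀ P, P ∈ T ↔
      (P = 0 ∧ Q.yy = 0) ∨ (P ≠ 0 ∧ Q.toCoord W.toAffine ∈ pointIdeal P)) :
      toPlane '' (T : Set W.toAffine.Point) = (stdForm W Q).branchPoints := by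
    ext p
    constructor
    · rintro ⟨P, hP, rfl⟩
      exact (toPlane_mem_branchPoints_iff Q hW P).mpr ((hT P).mp hP)
    · intro hp
      have hp' : p ∈ (stdForm W Q).planeCubic := fun F hF => hp F (by simp_all)
      rw [← range_toPlane Q hW hns] at hp'
      obtain ⟨P, rfl⟩ := hp'
      exact ⟨P, (hT P).mpr ((toPlane_mem_branchPoints_iff Q hW P).mp hp), rfl⟩
  have hmem' (P) : P ∈ S ↔ P ≠ 0 ∧ Q.toCoord W.toAffine ∈ pointIdeal P := by
    by_cases hP : P = 0
    · simp [hP, h0]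
    · simp [hmem P hP, hP]
  -- If `yy` vanishes there are five affine zeros and $O$ is the sixth; adding it does not change
  -- the sum.
  by_cases hyy : Q.yy = 0
  · refine ⟨insert 0 S, ?_, ?_, himage _ fun P => ?_⟩
    · rw [Finset.card_insert_of_notMem h0, hcard, if_pos hyy]
    · rw [Finset.sum_insert h0, hsum, add_zero]
    · rw [Finset.mem_insert, hmem', and_iff_left hyy]
  · refine ⟨S, by rw [hcard, if_neg hyy], hsum, himage _ fun P => ?_⟩
    rw [hmem']
    simp [hyy]

/-- Six points with sum zero are cut out by a transversal conic. -/
theorem exists_quad [DecidableEq K] (hW : W.IsCharNeTwoNF)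
    (hns : ∀ x y, W.toAffine.Equation x y → W.toAffine.Nonsingular x y)
    {S : Finset W.toAffine.Point} (hcard : S.card = 6) (hsum : ∑ P ∈ S, P = 0) :
    ∃ Q : Quad K, IsTransversal W Q ∧
      toPlane '' (S : Set W.toAffine.Point) = (stdForm W Q).branchPoints := by
  classical
  -- Discarding $O$ leaves only affine points, so the norm of the generator has degree 5 or 6
  -- according to whether $O$ is among the six points.
  have hsum' : ∑ P ∈ S.erase (0 : W.toAffine.Point), P = 0 := by rwa [Finset.sum_erase (f := fun P => P) _ rfl]
  obtain ⟨r, hr, hprod⟩ := (sum_eq_zero_iff _).mp hsum'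
  have hdeg := natDegree_norm_eq_card (fun P hP => Finset.ne_of_mem_erase hP) hr hprod
  obtain ⟨p, q, rfl⟩ := exists_eq_aeval_add r
  rw [natDegree_norm, Finset.card_erase_eq_ite, hcard] at hdeg
  have hle1 := le_max_left (2 * p.natDegree) (if q = 0 then 0 else 2 * q.natDegree + 3)
  have hle2 := le_max_right (2 * p.natDegree) (if q = 0 then 0 else 2 * q.natDegree + 3)
  have hle3 := max_choice (2 * p.natDegree) (if q = 0 then 0 else 2 * q.natDegree + 3)
  rw [hdeg] at hle1 hle2 hle3
  have hp : p.natDegree ≤ 3 := by split_ifs at hle1 <;> omega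
  have hq : q.natDegree ≤ 1 := by
    by_cases hq0 : q = 0
    · simp [hq0]
    · rw [if_neg hq0] at hle2
      split_ifs at hle2 <;> omega
  obtain ⟨Q, hyy, hxy, hQ⟩ := Quad.exists_eq_toCoord (W := W) hW hp hq
  rw [hQ] at hprod
  have hO : (0 : W.toAffine.Point) ∈ S ↔ Q.yy = 0 := by
    rw [hyy]
    constructor
    · intro h0
      rw [if_pos h0] at hle1
      exact coeff_eq_zero_of_natDegree_lt (by omega)
    · intro h3
      by_contra h0
      simp only [if_neg h0] at hle1 hle3
      -- Degree 6 is even, so it comes from $p$ and forces a nonzero $x^3$-coefficient.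
      have hne : (if q = 0 then 0 else 2 * q.natDegree + 3) ≠ 6 := by split_ifs <;> omega
      have : p.natDegree = 3 := by omega
      rw [← this, coeff_natDegree, leadingCoeff_eq_zero] at h3
      simp [h3] at this
  have hmem (P : W.toAffine.Point) (hP : P ≠ 0) :
      P ∈ S ↔ Q.toCoord W.toAffine ∈ pointIdeal P := by
    rw [← Ideal.span_singleton_le_iff_mem, ← hprod, prod_pointIdeal_le_iff hP, Finset.mem_erase,
      and_iff_right hP]
  refine ⟨Q, ⟨fun x y hc hv => ?_, fun h => ?_⟩, ?_⟩
  · have he := (equation_iff_cubicValue hW).mpr hc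
    refine affine_transversal_of_prod_eq_span hW hprod (hns x y he) ?_
    refine Finset.mem_erase.mpr ⟨Point.some_ne_zero _, (hmem _ (Point.some_ne_zero _)).mpr ?_⟩
    refine (mem_XYIdeal_iff he _).mpr ?_
    rw [evalAt_toCoord, hv]
  -- Degree 5 is odd, so it comes from $q$, which then has degree exactly 1.
  · simp only [if_pos (hO.mpr h)] at hle1 hle3
    rw [hxy]
    intro h1
    by_cases hq0 : q = 0
    · rw [if_pos hq0] at hle3
      omega
    · rw [if_neg hq0] at hle3
      have : q.natDegree = 1 := by omega
      rw [← this, coeff_natDegree, leadingCoeff_eq_zero] at h1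
      exact hq0 h1
  · ext a
    constructor
    · rintro ⟨P, hP, rfl⟩
      rw [toPlane_mem_branchPoints_iff Q hW]
      by_cases h0 : P = 0
      · exact .inl ⟨h0, hO.mp (h0 ▸ hP)⟩
      · exact .inr ⟨h0, (hmem P h0).mp hP⟩
    · intro ha
      have ha' : a ∈ (stdForm W Q).planeCubic := fun F hF => ha F (by simp_all)
      rw [← range_toPlane Q hW hns] at ha'
      obtain ⟨P, rfl⟩ := ha'
      refine ⟨P, ?_, rfl⟩
      rcases (toPlane_mem_branchPoints_iff Q hW P).mp ha with ⟨rfl, h⟩ | ⟨h0, h⟩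
      · exact hO.mpr h
      · exact (hmem P h0).mpr h

end Correspondence

/-! ### Uniqueness of the equations -/

section Uniqueness

variable {K : Type*} [Field K] [IsAlgClosed K] {W W' : WeierstrassCurve K} {Q Q' : Quad K}

/-- A plane cubic `y² z = f(x, z)` determines its equation. -/
theorem eq_of_planeCubic_eq (hW : W.IsCharNeTwoNF) (hW' : W'.IsCharNeTwoNF)
    (h : (stdForm W Q).planeCubic = (stdForm W' Q').planeCubic) : W = W' := by
  have hv (x : K) : x ^ 3 + W.a₂ * x ^ 2 + W.a₄ * x + W.a₆
      = x ^ 3 + W'.a₂ * x ^ 2 + W'.a₄ * x + W'.a₆ := by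
    obtain ⟨y, hy⟩ := IsAlgClosed.exists_pow_nat_eq
      (x ^ 3 + W.a₂ * x ^ 2 + W.a₄ * x + W.a₆) two_pos
    have hne : ![x, y, 1] ≠ 0 := fun h => one_ne_zero (congrFun h 2)
    have h1 : Projectivization.mk K ![x, y, 1] hne ∈ (stdForm W Q).planeCubic := by
      rw [mk_mem_planeCubic]
      simp only [cubicValue, Matrix.cons_val]
      linear_combination hy
    rw [h, mk_mem_planeCubic] at h1
    simp only [cubicValue, Matrix.cons_val] at h1
    linear_combination -hy + h1
  have hp : (⟨1, W.a₂, W.a₄, W.a₆⟩ : Cubic K).toPoly = (⟨1, W'.a₂, W'.a₄, W'.a₆⟩ : Cubic K).toPoly :=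
    Polynomial.funext fun x => by simpa [Cubic.toPoly] using hv x
  have := (Cubic.toPoly_injective _ _).mp hp
  simp only [Cubic.mk.injEq] at this
  ext
  exacts [hW.a₁.trans hW'.a₁.symm, this.2.1, hW.a₃.trans hW'.a₃.symm, this.2.2.1, this.2.2.2]

/-- The affine curve has infinitely many points. -/
theorem exists_point_notMem (hns : ∀ x y, W.toAffine.Equation x y → W.toAffine.Nonsingular x y)
    (hW : W.IsCharNeTwoNF) (S : Finset W.toAffine.Point) : ∃ P ∉ S, P ≠ 0 := by
  classical
  let xs : W.toAffine.Point → K := fun P => match P with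
    | .zero => 0
    | .some x _ _ => x
  obtain ⟨x, hx⟩ := Infinite.exists_notMem_finset (S.image xs)
  obtain ⟨y, hy⟩ := IsAlgClosed.exists_pow_nat_eq
    (x ^ 3 + W.a₂ * x ^ 2 + W.a₄ * x + W.a₆) two_pos
  have he : W.toAffine.Equation x y := (equation_iff_cubicValue hW).mpr (by
    simp only [cubicValue]
    linear_combination hy)
  exact ⟨.some x y (hns x y he), fun hS => hx (Finset.mem_image_of_mem xs hS), Point.some_ne_zero _⟩

/-- A conic meeting the cubic in the same points as a transversal one is a multiple of it. -/
theorem exists_eq_scale (hW : W.IsCharNeTwoNF)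
    (hns : ∀ x y, W.toAffine.Equation x y → W.toAffine.Nonsingular x y) (h : IsTransversal W Q)
    (hb : (stdForm W Q).branchPoints = (stdForm W Q').branchPoints) :
    ∃ c : K, c ≠ 0 ∧ Q' = Q.scale c := by
  classical
  obtain ⟨S, h0, hmem, hprod, hcard⟩ := exists_affine_zeros hW hns h
  have hiff (P : W.toAffine.Point) := (toPlane_mem_branchPoints_iff Q hW P).symm.trans
    ((Set.ext_iff.mp hb _).trans (toPlane_mem_branchPoints_iff Q' hW P))
  have hyy : Q.yy = 0 ↔ Q'.yy = 0 := by simpa using hiff 0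
  have hmem' (P : W.toAffine.Point) (hP : P ≠ 0) : P ∈ S ↔ Q'.toCoord W.toAffine ∈ pointIdeal P := by
    rw [hmem P hP]
    simpa [hP] using hiff P
  have hmemJ : Q'.toCoord W.toAffine ∈ Ideal.span {Q.toCoord W.toAffine} := by
    rw [← hprod, mem_prod_pointIdeal]
    exact fun P hP => (hmem' P fun e => h0 (e ▸ hP)).mp hP
  obtain ⟨r, hr⟩ := Ideal.mem_span_singleton.mp hmemJ
  -- Otherwise every affine point would be a zero, but there are infinitely many of them.
  have hne' : Q'.toCoord W.toAffine ≠ 0 := by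
    intro e
    obtain ⟨P, hPS, hP⟩ := exists_point_notMem hns hW S
    exact hPS ((hmem' P hP).mpr (e ▸ zero_mem _))
  have hr0 : r ≠ 0 := by
    rintro rfl
    exact hne' (by rw [hr, mul_zero])
  have hnorm : Algebra.norm K[X] (Q'.toCoord W.toAffine)
      = Algebra.norm K[X] (Q.toCoord W.toAffine) * Algebra.norm K[X] r := by
    rw [hr, map_mul]
  have hn {s : W.toAffine.CoordinateRing} (hs : s ≠ 0) : Algebra.norm K[X] s ≠ 0 := by
    have := Module.Finite.of_basis (CoordinateRing.basis W.toAffine)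
    exact Algebra.norm_ne_zero_iff.mpr hs
  have hdeg := congrArg natDegree hnorm
  rw [natDegree_mul (hn (Q.toCoord_ne_zero hW h.infinity)) (hn hr0),
    Q.natDegree_norm_toCoord hW h.infinity] at hdeg
  have hle := Q'.natDegree_norm_toCoord_le hW
  simp only [← hyy] at hle
  -- Both forms have the same bound 5 or 6, since `yy` vanishes for both or for neither, and the
  -- transversal one attains it. So the cofactor has norm of degree 0 and is constant.
  have hrdeg : (Algebra.norm K[X] r).natDegree = 0 := by omega
  obtain ⟨p, q, rfl⟩ := exists_eq_aeval_add r
  rw [natDegree_norm] at hrdeg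
  have hp : p.natDegree = 0 := by omega
  have hq : q = 0 := by
    by_contra hq
    rw [if_neg hq] at hrdeg
    omega
  rw [eq_C_of_natDegree_eq_zero hp, hq, map_zero, zero_mul, add_zero, aeval_C] at hr hr0
  refine ⟨p.coeff 0, fun e => hr0 (by rw [e, map_zero]), Quad.toCoord_injective hW ?_⟩
  rw [Quad.toCoord_scale, hr, mul_comm]

end Uniqueness

/-! ### Rescaling $w$ and projecting to the plane -/

section ProjectiveMaps

variable {K : Type*} [Field K]

theorem projMap_mk {n : ℕ} (g : (Fin n → K) ≃ₗ[K] (Fin n → K)) {v : Fin n → K} (hv : v ≠ 0) :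
    projMap g (Projectivization.mk K v hv)
      = Projectivization.mk K (g v) (g.map_ne_zero_iff.mpr hv) := rfl

theorem mk_mem_image_projMap {n : ℕ} (g : (Fin n → K) ≃ₗ[K] (Fin n → K))
    (A : Set (ℙ K (Fin n → K))) {v : Fin n → K} (hv : v ≠ 0) :
    Projectivization.mk K v hv ∈ projMap g '' A ↔
      Projectivization.mk K (g.symm v) (g.symm.map_ne_zero_iff.mpr hv) ∈ A := by
  have hinj : Function.Injective (projMap g) := Projectivization.map_injective _ _
  rw [← hinj.mem_set_image (s := A), projMap_mk]
  simp only [LinearEquiv.apply_symm_apply]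

theorem mk_mem_image_scaleW (W : WeierstrassCurve K) (Q : Quad K) (u : Kˣ) {v : Fin 4 → K}
    (hv : v ≠ 0) : Projectivization.mk K v hv ∈ projMap (scaleW u) '' (stdForm W Q).curve ↔
      cubicValue W (v 0) (v 1) (v 2) = 0 ∧ v 3 ^ 2 = u ^ 2 * Q.value (v 0) (v 1) (v 2) := by
  rw [mk_mem_image_projMap, mk_mem_curve]
  have h (i : Fin 4) (hi : i ≠ 3) : (scaleW u).symm v i = v i := by
    simp [scaleW, hi, LinearEquiv.smulOfUnit]
  have h3 : v 3 = u * (scaleW u).symm v 3 := by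
    simp [scaleW, LinearEquiv.smulOfUnit, Units.smul_def]
  rw [h 0 (by decide), h 1 (by decide), h 2 (by decide), h3, mul_pow,
    mul_right_inj' (pow_ne_zero 2 u.ne_zero)]

variable {W W' : WeierstrassCurve K} {Q Q' : Quad K}

theorem Quad.value_scale (c x y z : K) : (Q.scale c).value x y z = c * Q.value x y z := by
  simp only [value, scale]
  ring

theorem curve_scale (u : Kˣ) : (stdForm W (Q.scale (u ^ 2 : K))).curve
    = projMap (scaleW u) '' (stdForm W Q).curve := by
  ext p
  induction p with | h v hv => ?_
  rw [mk_mem_image_scaleW, mk_mem_curve, Quad.value_scale]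

/-- The projection of the space curve determines the plane cubic and the branch points. -/
theorem loci_eq_of_curve_eq [IsAlgClosed K] {u : Kˣ}
    (h : (stdForm W' Q').curve = projMap (scaleW u) '' (stdForm W Q).curve) :
    (stdForm W' Q').planeCubic = (stdForm W Q).planeCubic ∧
      (stdForm W' Q').branchPoints = (stdForm W Q).branchPoints := by
  have key (v : Fin 3 → K) (hv : v ≠ 0) (w : K) :
      (cubicValue W' (v 0) (v 1) (v 2) = 0 ∧ w ^ 2 = Q'.value (v 0) (v 1) (v 2)) ↔
      (cubicValue W (v 0) (v 1) (v 2) = 0 ∧ w ^ 2 = u ^ 2 * Q.value (v 0) (v 1) (v 2)) := by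
    have hne : ![v 0, v 1, v 2, w] ≠ 0 := fun e => hv (by
      ext i
      fin_cases i
      exacts [congrFun e 0, congrFun e 1, congrFun e 2])
    exact (mk_mem_curve W' Q' hne).symm.trans
      ((Set.ext_iff.mp h _).trans (mk_mem_image_scaleW W Q u hne))
  constructor
  · ext p
    induction p with | h v hv => ?_
    rw [mk_mem_planeCubic, mk_mem_planeCubic]
    constructor
    · intro hc
      obtain ⟨w, hw⟩ := IsAlgClosed.exists_pow_nat_eq (Q'.value (v 0) (v 1) (v 2)) two_pos
      exact ((key v hv w).mp ⟨hc, hw⟩).1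
    · intro hc
      obtain ⟨w, hw⟩ := IsAlgClosed.exists_pow_nat_eq (u ^ 2 * Q.value (v 0) (v 1) (v 2)) two_pos
      exact ((key v hv w).mpr ⟨hc, hw⟩).1
  · ext p
    induction p with | h v hv => ?_
    rw [mk_mem_branchPoints, mk_mem_branchPoints]
    -- The branch points are the points of the plane below $w=0$.
    simpa [eq_comm (a := (0 : K))] using key v hv 0

end ProjectiveMaps

/-! ### Reduction of a general Weierstrass equation to normal form -/

section CompletingTheSquare

variable {K : Type*} [Field K]

/-- The Weierstrass curve obtained by completing the square. -/
def completeSquare (E : WeierstrassCurve K) (s t : K) : WeierstrassCurve K :=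
  ⟨0, E.a₂ + s ^ 2, 0, E.a₄ + 2 * s * t, E.a₆ + t ^ 2⟩

variable {E : WeierstrassCurve K} {s t : K} (hs : E.a₁ = 2 * s) (ht : E.a₃ = 2 * t)

include hs ht

theorem completeSquare_isElliptic (hE : E.IsElliptic) : (completeSquare E s t).IsElliptic := by
  refine ⟨?_⟩
  convert! hE.isUnit using 1
  simp only [WeierstrassCurve.Δ, WeierstrassCurve.b₂, WeierstrassCurve.b₄, WeierstrassCurve.b₆,
    WeierstrassCurve.b₈, completeSquare, hs, ht]
  ring

theorem completeSquare_equation {x y : K} (h : E.toAffine.Equation x y) :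
    (completeSquare E s t).toAffine.Equation x (y + (s * x + t)) := by
  rw [equation_iff, hs, ht] at h
  rw [equation_iff]
  simp only [completeSquare]
  linear_combination h

/-- Completing the square maps the ideals of points to the ideals of points. -/
theorem exists_map_XYIdeal : ∃ τ : E.toAffine.CoordinateRing →+*
    (completeSquare E s t).toAffine.CoordinateRing, Function.Injective τ ∧
      ∀ x y : K, (CoordinateRing.XYIdeal E.toAffine x (C y)).map τ
        = CoordinateRing.XYIdeal (completeSquare E s t).toAffine x (C (y + (s * x + t))) := by
  set E' := completeSquare E s t with hE'
  let c := algebraMap K E'.toAffine.CoordinateRing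
  have he : (yCoord E'.toAffine - (c s * xCoord E'.toAffine + c t)) ^ 2
      + c E.a₁ * xCoord E'.toAffine * (yCoord E'.toAffine - (c s * xCoord E'.toAffine + c t))
      + c E.a₃ * (yCoord E'.toAffine - (c s * xCoord E'.toAffine + c t))
      = xCoord E'.toAffine ^ 3 + c E.a₂ * xCoord E'.toAffine ^ 2
      + c E.a₄ * xCoord E'.toAffine + c E.a₆ := by
    have e := coord_equation (W := E'.toAffine)
    have h2 : E'.a₂ = E.a₂ + s ^ 2 := rfl
    have h4 : E'.a₄ = E.a₄ + 2 * s * t := rfl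
    have h6 : E'.a₆ = E.a₆ + t ^ 2 := rfl
    have h1 : E'.a₁ = 0 := rfl
    have h3 : E'.a₃ = 0 := rfl
    simp only [h1, h2, h3, h4, h6, map_add, map_mul, map_pow, map_zero, map_ofNat] at e
    simp only [hs, ht, map_mul, map_ofNat]
    simp only [c]
    linear_combination e
  refine ⟨(coordHom (W := E.toAffine) _ _ he).toRingHom, ?_, fun x y => ?_⟩
  · rw [injective_iff_map_eq_zero]
    -- The image of $p+qy$ is $(p-q(sX+t))+qY$, and $1,Y$ form a basis, so first $q$ and then $p$
    -- vanishes.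
    intro r hr
    obtain ⟨p, q, rfl⟩ := exists_eq_aeval_add r
    simp only [AlgHom.toRingHom_eq_coe, RingHom.coe_coe, map_add, map_mul, ← aeval_algHom_apply,
      coordHom_xCoord, coordHom_yCoord] at hr
    have hr' : aeval (xCoord E'.toAffine) (p - q * (C s * X + C t))
        + aeval (xCoord E'.toAffine) q * yCoord _ = 0 := by
      simp only [map_sub, map_add, map_mul, aeval_C, aeval_X]
      simp only [c] at hr
      linear_combination hr
    obtain ⟨hp, rfl⟩ := CoordinateRing.smul_basis_eq_zero
      ((aeval_add_eq_smul_basis _ _).symm.trans hr')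
    simp_all
  · rw [XYIdeal_eq_span, XYIdeal_eq_span, Ideal.map_span, Set.image_pair,
      ← Ideal.span_pair_add_left_mul _ _ (c s)]
    congr 2
    · simp
    · congr 1
      simp only [AlgHom.toRingHom_eq_coe, RingHom.coe_coe, map_sub, map_add, map_mul,
        coordHom_xCoord, coordHom_yCoord, AlgHom.commutes, c]
      ring

end CompletingTheSquare

section CompletingTheSquare

variable {K : Type*} [Field K] {E : WeierstrassCurve K} {s t : K}

/-- Completing the square on points. -/
def completeSquarePoint (hE : (completeSquare E s t).IsElliptic) (hs : E.a₁ = 2 * s)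
    (ht : E.a₃ = 2 * t) : E.toAffine.Point → (completeSquare E s t).toAffine.Point
  | .zero => .zero
  | .some x y h => .some x (y + (s * x + t))
      (equation_iff_nonsingular.mp (completeSquare_equation hs ht h.1))

/-- Completing the square as a linear automorphism of the plane. -/
def completeSquareEquiv (s t : K) : (Fin 3 → K) ≃ₗ[K] (Fin 3 → K) where
  toFun v := ![v 0, v 1 + (s * v 0 + t * v 2), v 2]
  invFun v := ![v 0, v 1 - (s * v 0 + t * v 2), v 2]
  map_add' v w := by
    ext i
    fin_cases i <;> simp
    ring
  map_smul' a v := by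
    ext i
    fin_cases i <;> simp
    ring
  left_inv v := by
    ext i
    fin_cases i <;> simp
  right_inv v := by
    ext i
    fin_cases i <;> simp

variable (hE : (completeSquare E s t).IsElliptic) (hs : E.a₁ = 2 * s) (ht : E.a₃ = 2 * t)

theorem toPlane_completeSquarePoint (P : E.toAffine.Point) :
    toPlane (completeSquarePoint hE hs ht P) = projMap (completeSquareEquiv s t) (toPlane P) := by
  rcases P with _ | ⟨x, y, h⟩
  · refine (Projectivization.mk_eq_mk_iff' ..).mpr ⟨1, ?_⟩
    ext i
    fin_cases i <;> simp [completeSquareEquiv]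
  · refine (Projectivization.mk_eq_mk_iff' ..).mpr ⟨1, ?_⟩
    ext i
    fin_cases i <;> simp [completeSquareEquiv]

theorem completeSquarePoint_injective : Function.Injective (completeSquarePoint hE hs ht) := by
  rintro (_ | ⟨x, y, h⟩) (_ | ⟨x', y', h'⟩) e
  · rfl
  · exact absurd e.symm (Point.some_ne_zero _)
  · exact absurd e (Point.some_ne_zero _)
  · simp only [completeSquarePoint, Point.some.injEq] at e
    obtain ⟨rfl, e⟩ := e
    obtain rfl := add_right_cancel e
    rfl

theorem completeSquarePoint_surjective [E.IsElliptic] :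
    Function.Surjective (completeSquarePoint hE hs ht) := by
  rintro (_ | ⟨x, y, h⟩)
  · exact ⟨.zero, rfl⟩
  · have he : E.toAffine.Equation x (y - (s * x + t)) := by
      have := (equation_iff ..).mp h.1
      simp only [completeSquare] at this
      rw [equation_iff, hs, ht]
      linear_combination this
    refine ⟨.some x _ (equation_iff_nonsingular.mp he), ?_⟩
    simp [completeSquarePoint]

/-- The map of points need not be known to be a homomorphism: the ring map carries point ideals to
point ideals, hence a generator of the product to a generator. -/
theorem sum_completeSquarePoint [DecidableEq K] {S : Finset E.toAffine.Point}
    (hS : ∑ P ∈ S, P = 0) : ∑ P ∈ S.image (completeSquarePoint hE hs ht), P = 0 := by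
  obtain ⟨τ, hτ, hmap⟩ := exists_map_XYIdeal hs ht
  obtain ⟨r, hr, hprod⟩ := (sum_eq_zero_iff S).mp hS
  rw [sum_eq_zero_iff]
  refine ⟨τ r, (map_ne_zero_iff τ hτ).mpr hr, ?_⟩
  have := congrArg (Ideal.mapHom τ) hprod
  rw [map_prod] at this
  simp only [Ideal.mapHom_apply, Ideal.map_span, Set.image_singleton] at this
  rw [← this, Finset.prod_image (completeSquarePoint_injective hE hs ht).injOn]
  refine Finset.prod_congr rfl fun P _ => ?_
  rcases P with _ | ⟨x, y, h⟩
  · exact (Ideal.map_top τ).symm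
  · exact (hmap x y).symm

end CompletingTheSquare

/-! ### Assembling the correspondence -/

section Main

variable {K : Type*} [Field K]

namespace SixPointedEllipticCurve

theorem nonsingular_of_equation [DecidableEq K] (M : SixPointedEllipticCurve K) (x y : K)
    (h : M.E.toAffine.Equation x y) : M.E.toAffine.Nonsingular x y :=
  have := M.isElliptic
  equation_iff_nonsingular.mp h

theorem curve_eq_planeCubic [DecidableEq K] (M : SixPointedEllipticCurve K)
    (h : M.E.IsCharNeTwoNF) (Q : Quad K) : M.curve = (stdForm M.E Q).planeCubic :=
  range_toPlane Q h M.nonsingular_of_equation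

theorem exists_form [DecidableEq K] (hK : (2 : K) ≠ 0) (M : SixPointedEllipticCurve K)
    (h : M.E.IsCharNeTwoNF) : ∃ D : Form K, D.IsNonsingular ∧ Corresponds D M := by
  obtain ⟨Q, hQ, hb⟩ := exists_quad h M.nonsingular_of_equation M.card_eq M.sum_eq
  exact ⟨stdForm M.E Q, isNonsingular_of_isTransversal hK h M.nonsingular_of_equation hQ,
    M.curve_eq_planeCubic h Q, hb⟩

/-- Completing the square transforms a six-pointed elliptic curve into one in normal form. -/
theorem exists_normalForm [DecidableEq K] (hK : (2 : K) ≠ 0) (M : SixPointedEllipticCurve K) :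
    ∃ (M' : SixPointedEllipticCurve K) (g : (Fin 3 → K) ≃ₗ[K] (Fin 3 → K)), M'.E.IsCharNeTwoNF ∧
      projMap g (toPlane (0 : M.E.toAffine.Point)) = toPlane (0 : M.E.toAffine.Point) ∧
      projMap g '' M.curve = M'.curve ∧ projMap g '' M.points = M'.points := by
  have hs : M.E.a₁ = 2 * (M.E.a₁ / 2) := (mul_div_cancel₀ _ hK).symm
  have ht : M.E.a₃ = 2 * (M.E.a₃ / 2) := (mul_div_cancel₀ _ hK).symm
  have hE := completeSquare_isElliptic hs ht M.isElliptic
  have := M.isElliptic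
  refine ⟨⟨completeSquare M.E (M.E.a₁ / 2) (M.E.a₃ / 2), hE,
    M.S.image (completeSquarePoint hE hs ht), ?_, sum_completeSquarePoint hE hs ht M.sum_eq⟩,
    completeSquareEquiv (M.E.a₁ / 2) (M.E.a₃ / 2), ⟨rfl, rfl⟩, ?_, ?_, ?_⟩
  · rw [Finset.card_image_of_injective _ (completeSquarePoint_injective hE hs ht), M.card_eq]
  · exact (toPlane_completeSquarePoint hE hs ht 0).symm
  · rw [curve, curve, ← Set.range_comp, ← (completeSquarePoint_surjective hE hs ht).range_comp]
    exact congrArg Set.range (funext fun P => (toPlane_completeSquarePoint hE hs ht P).symm)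
  · rw [points, points, Finset.coe_image, Set.image_image, Set.image_image]
    exact Set.image_congr fun P _ => (toPlane_completeSquarePoint hE hs ht P).symm

end SixPointedEllipticCurve

theorem existsUnique_sixPointed [DecidableEq K] [IsAlgClosed K] (hK : (2 : K) ≠ 0) (D : Form K)
    (hD : D.IsNonsingular) :
    ∃! M : SixPointedEllipticCurve K, M.E.IsCharNeTwoNF ∧ Corresponds D M := by
  obtain ⟨W, Q, hW, rfl⟩ := exists_eq_stdForm D
  have hns := nonsingular_of_isNonsingular hW hD
  obtain ⟨S, hcard, hsum, hb⟩ := exists_six_points hW hns (isTransversal_of_isNonsingular hW hD)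
  let M : SixPointedEllipticCurve K := ⟨W, isElliptic_of_nonsingular hK hW hns, S, hcard, hsum⟩
  refine ⟨M, ⟨hW, M.curve_eq_planeCubic hW Q, hb⟩, ?_⟩
  rintro M' ⟨hM', hc, hb'⟩
  have hE : M'.E = W :=
    eq_of_planeCubic_eq (Q := Q) hM' hW ((M'.curve_eq_planeCubic hM' Q).symm.trans hc)
  obtain ⟨E, hell, S', hcard', hsum'⟩ := M'
  obtain rfl : E = W := hE
  have hS : (S' : Set E.toAffine.Point) = S :=
    (toPlane_injective E).image_injective (hb'.trans hb.symm)
  obtain rfl := Finset.coe_injective hS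
  rfl

theorem corresponds_iff [DecidableEq K] {D D' : Form K} {M : SixPointedEllipticCurve K}
    (h : Corresponds D M) : Corresponds D' M ↔
      D'.planeCubic = D.planeCubic ∧ D'.branchPoints = D.branchPoints := by
  rw [Corresponds, h.1, h.2, eq_comm, eq_comm (a := D.branchPoints)]

theorem planeCubic_stdForm (W : WeierstrassCurve K) (Q Q' : Quad K) :
    (stdForm W Q).planeCubic = (stdForm W Q').planeCubic := by
  ext p
  induction p with | h v hv => ?_
  rw [mk_mem_planeCubic, mk_mem_planeCubic]

theorem branchPoints_scale {c : K} (hc : c ≠ 0) (W : WeierstrassCurve K) (Q : Quad K) :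
    (stdForm W (Q.scale c)).branchPoints = (stdForm W Q).branchPoints := by
  ext p
  induction p with | h v hv => ?_
  simp [mk_mem_branchPoints, Quad.value_scale, hc]

/-- The forms with the same plane cubic and the same branch points as a nonsingular one. -/
theorem loci_eq_iff [DecidableEq K] [IsAlgClosed K] {W : WeierstrassCurve K} {Q : Quad K}
    (hW : W.IsCharNeTwoNF) (hD : (stdForm W Q).IsNonsingular) (D' : Form K) :
    (D'.planeCubic = (stdForm W Q).planeCubic ∧ D'.branchPoints = (stdForm W Q).branchPoints) ↔
      ∃ c : K, c ≠ 0 ∧ D' = stdForm W (Q.scale c) := by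
  constructor
  · rintro ⟨hc, hb⟩
    obtain ⟨W', Q', hW', rfl⟩ := exists_eq_stdForm D'
    obtain rfl := eq_of_planeCubic_eq hW' hW hc
    obtain ⟨c, hc0, rfl⟩ := exists_eq_scale hW (nonsingular_of_isNonsingular hW hD)
      (isTransversal_of_isNonsingular hW hD) hb.symm
    exact ⟨c, hc0, rfl⟩
  · rintro ⟨c, hc, rfl⟩
    exact ⟨planeCubic_stdForm W _ _, branchPoints_scale hc W Q⟩

theorem eq_stdForm_scale_iff {W : WeierstrassCurve K} {Q : Quad K} {D' : Form K} {c : K} :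
    D' = stdForm W (Q.scale c) ↔
      D'.f = (stdForm W Q).f ∧ D'.q = MvPolynomial.C c * (stdForm W Q).q := by
  have : MvPolynomial.C c * (stdForm W Q).q = (Q.scale c).toMvPolynomial :=
    (Q.toMvPolynomial_scale c).symm
  rw [this]
  cases D'
  simp [stdForm]

end Main

end DoubleCover

theorem mainTheorem3 {K : Type*} [Field K] [DecidableEq K] [IsAlgClosed K] (hK : (2 : K) ≠ 0) :
    -- a nonsingular `C` determines an elliptic curve with six points of sum `O`
    (∀ D : DoubleCover.Form K, D.IsNonsingular →
      ∃! M : DoubleCover.SixPointedEllipticCurve K,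
        M.E.IsCharNeTwoNF ∧ DoubleCover.Corresponds D M) ∧
    -- every elliptic curve `y² z = f(x, z)` with six points of sum `O` arises
    (∀ M : DoubleCover.SixPointedEllipticCurve K, M.E.IsCharNeTwoNF →
      ∃ D : DoubleCover.Form K, D.IsNonsingular ∧ DoubleCover.Corresponds D M) ∧
    -- and it determines `f`, determines `q` up to a factor, and `C` up to rescaling `w`
    (∀ (D D' : DoubleCover.Form K) (M : DoubleCover.SixPointedEllipticCurve K),
      D.IsNonsingular → DoubleCover.Corresponds D M →
        (DoubleCover.Corresponds D' M ↔
          D'.f = D.f ∧ ∃ c : K, c ≠ 0 ∧ D'.q = MvPolynomial.C c * D.q) ∧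
        (DoubleCover.Corresponds D' M ↔
          ∃ u : Kˣ, D'.curve = DoubleCover.projMap (DoubleCover.scaleW u) '' D.curve)) ∧
    -- an arbitrary elliptic curve with six points of sum `O` arises after an isomorphism
    (∀ M : DoubleCover.SixPointedEllipticCurve K,
      ∃ (D : DoubleCover.Form K) (g : (Fin 3 → K) ≃ₗ[K] (Fin 3 → K)), D.IsNonsingular ∧
        DoubleCover.projMap g (DoubleCover.toPlane (0 : M.E.toAffine.Point)) =
          DoubleCover.toPlane (0 : M.E.toAffine.Point) ∧
        DoubleCover.projMap g '' M.curve = D.planeCubic ∧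
        DoubleCover.projMap g '' M.points = D.branchPoints)
 := by
  refine ⟨DoubleCover.existsUnique_sixPointed hK,
    fun M hM => M.exists_form hK hM, fun D D' M hD hM => ?_, fun M => ?_⟩
  · obtain ⟨W, Q, hW, rfl⟩ := DoubleCover.exists_eq_stdForm D
    rw [DoubleCover.corresponds_iff hM]
    constructor
    · rw [DoubleCover.loci_eq_iff hW hD]
      simp only [DoubleCover.eq_stdForm_scale_iff]
      tauto
    · constructor
      · rw [DoubleCover.loci_eq_iff hW hD]
        rintro ⟨c, hc, rfl⟩
        -- Rescaling $w$ by $u$ multiplies $q$ by $u^2$, so a square root of $c$ is needed.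
        obtain ⟨u, rfl⟩ := IsAlgClosed.exists_pow_nat_eq c two_pos
        have hu : u ≠ 0 := fun h => hc (by rw [h, zero_pow two_ne_zero])
        exact ⟨Units.mk0 u hu, DoubleCover.curve_scale (Units.mk0 u hu)⟩
      · rintro ⟨u, hu⟩
        obtain ⟨W', Q', -, rfl⟩ := DoubleCover.exists_eq_stdForm D'
        exact DoubleCover.loci_eq_of_curve_eq hu
  · obtain ⟨M', g, hM', hO, hc, hp⟩ := M.exists_normalForm hK
    obtain ⟨D, hD, hDc, hDp⟩ := M'.exists_form hK hM'
    exact ⟨D, g, hD, hO, hc.trans hDc, hp.trans hDp⟩
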